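/- **Setting.** Let $G$ be a group and $K$ a field with $\operatorname{char}K\neq 2$. The Green ring $R_K(G)$ is generated additively by the isomorphism classes $[V]$ of finite-dimensional $KG$-modules, with $[U]+[W]=[U\oplus W]$ and $[U][W]=[U\otimes W]$ (so it is free abelian on the classes of indecomposable modules), and $\Gamma_K(G)=\mathbb C\otimes_{\mathbb Z}R_K(G)$ is the Green algebra. Let $\widehat\Gamma$ be a free abelian group of finite rank with $\mathbb Z$-basis $(\alpha_i)$, and write $\operatorname{ht}\bigl(\sum_i k_i\alpha_i\bigr)=\sum_i k_i$. Let $\Gamma\subseteq\widehat\Gamma$ be a sub-semigroup such that every element of $\Gamma$ is a sum of elements of $\Gamma$ in only finitely many ways, $\operatorname{ht}(\alpha)\ge 1$ for all $\alpha\in\Gamma$, and only finitely many elements of $\Gamma$ have any given height. (For example, $\Gamma=\{\sum_i k_i\alpha_i : k_i\in\mathbb Z_{\ge0}\}\setminus\{0\}$.) For a commutative $\mathbb C$-algebra $R$ let $R[[\Gamma\times\mathbb Z_2]]$ be the (non-unital) algebra of formal sums $\sum_{(\alpha,a)\in\Gamma\times\mathbb Z_2}\zeta(\alpha,a)e^{(\alpha,a)}$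 with $\zeta(\alpha,a)\in R$ and $e^{(\alpha,a)}e^{(\beta,b)}=e^{(\alpha+\beta,a+b)}$. Let $R[[\Gamma\times\mathbb Z_2]]^{(n)}$ be the set of those sums with $\zeta(\alpha,a)=0$ whenever $\operatorname{ht}(\alpha)<n$. For $c\in\mathbb C$ put $(1+f)^c=1+\sum_{k\ge1}\frac{c(c-1)\cdots(c-k+1)}{k!}f^k$. A function $L:R[[\Gamma\times\mathbb Z_2]]\to R[[\Gamma\times\mathbb Z_2]]$ is *logarithmic* if 1. $L(R[[\Gamma\times\mathbb Z_2]]^{(n)})\subseteq R[[\Gamma\times\mathbb Z_2]]^{(n)}$ for all $n\ge1$; 2. $L(f)+L(g)=L(f+g-fg)$ for all $f,g$; 3. $c\,L(f)=L(1-(1-f)^c)$ for all $c\in\mathbb C$ and all $f$. A $(\Gamma\times\mathbb Z_2)$-graded $KG$-module is $V=\bigoplus_{(\alpha,a)}V_{(\alpha,a)}$ with each $V_{(\alpha,a)}$ a finite-dimensional $KG$-module; put $[V]=\sum_{(\alpha,a)}[V_{(\alpha,a)}]e^{(\alpha,a)}\in\Gamma_K(G)[[\Gamma\times\mathbb Z_2]]$.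 Let $\mathfrak L(V)$ be the free Lie superalgebra over $K$ generated by $V$, with parity given by the $\mathbb Z_2$-degree. (The axioms of a Lie superalgebra are super-skew-symmetry, the super Jacobi identity and, if $\operatorname{char}K=3$, also $[x,[x,x]]=0$ for odd $x$.) It carries the induced $(\Gamma\times\mathbb Z_2)$-grading and the induced action of $G$. **Theorem.** For every $(\Gamma\times\mathbb Z_2)$-graded $KG$-module $V$, all components $\mathfrak L(V)_{(\alpha,a)}$ are finite-dimensional, so that $[\mathfrak L(V)]$ is defined, and there exists a unique logarithmic function $\mathcal D$ on $\Gamma_K(G)[[\Gamma\times\mathbb Z_2]]$ such that $$[\mathfrak L(V)]=\mathcal D([V])$$ for every $(\Gamma\times\mathbb Z_2)$-graded $KG$-module $V$. -/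

import Mathlib

open scoped TensorProduct

universe u v w x

noncomputable section

/-! ### Isomorphism classes of finite dimensional `KG`-modules and the Green algebra -/

namespace Green


variable (K : Type u) [Field K] (G : Type v) [Group G]

/-- A finite dimensional `KG`-module whose underlying vector space is `K ^ n`. -/
abbrev MatRep : Type (max u v) := Σ n : ℕ, Representation K G (Fin n → K)

/-- Two such modules are equivalent when they are isomorphic as `KG`-modules. -/
instance matRepSetoid : Setoid (MatRep K G) where
  r A B := Nonempty (A.2.Equiv B.2)
  iseqv :=
    { refl := fun A => ⟨Representation.Equiv.refl A.2⟩
      symm := fun ⟨e⟩ => ⟨e.symm⟩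
      trans := fun ⟨e⟩ ⟨f⟩ => ⟨e.trans f⟩ }

/-- The set of isomorphism classes of finite dimensional `KG`-modules. -/
def IsoClass : Type (max u v) := Quotient (matRepSetoid K G)

variable {K G}
variable {V : Type w} [AddCommGroup V] [Module K V]
variable {W : Type x} [AddCommGroup W] [Module K W]

/-- Transport of a `KG`-module structure along a linear isomorphism. -/
def transport (ρ : Representation K G V) (e : V ≃ₗ[K] W) : Representation K G W where
  toFun g := e.toLinearMap ∘ₗ ρ g ∘ₗ e.symm.toLinearMap
  map_one' := by ext x; simp
  map_mul' g h := by ext x; simp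

/-- A `KG`-module is isomorphic to its transport along a linear isomorphism. -/
def transportEquiv (ρ : Representation K G V) (e : V ≃ₗ[K] W) :
    ρ.Equiv (transport ρ e) :=
  Representation.Equiv.mk e (fun g => by ext x; simp [transport])

/-- The isomorphism class of a finite dimensional `KG`-module, in any universe. -/
def isoClass [Module.Finite K V] (ρ : Representation K G V) : IsoClass K G :=
  Quotient.mk (matRepSetoid K G)
    ⟨Module.finrank K V, transport ρ (Module.finBasis K V).equivFun⟩

theorem isoClass_eq [Module.Finite K V] [Module.Finite K W] {ρ : Representation K G V}
    {σ : Representation K G W} (e : ρ.Equiv σ) : isoClass ρ = isoClass σ :=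
  Quotient.sound ⟨((transportEquiv ρ _).symm.trans e).trans (transportEquiv σ _)⟩

theorem exists_equiv_of_isoClass_eq [Module.Finite K V] [Module.Finite K W]
    {ρ : Representation K G V} {σ : Representation K G W} (h : isoClass ρ = isoClass σ) :
    Nonempty (ρ.Equiv σ) := by
  obtain ⟨e⟩ := Quotient.exact h
  exact ⟨((transportEquiv ρ _).trans e).trans (transportEquiv σ _).symm⟩

theorem isoClass_mk (A : MatRep K G) : isoClass A.2 = Quotient.mk (matRepSetoid K G) A :=
  Quotient.sound ⟨(transportEquiv A.2 _).symm⟩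

/-- Direct sums of isomorphic modules are isomorphic. -/
def prodCongr {V₁ W₁ V₂ W₂ : Type*} [AddCommGroup V₁] [Module K V₁] [AddCommGroup W₁]
    [Module K W₁] [AddCommGroup V₂] [Module K V₂] [AddCommGroup W₂] [Module K W₂]
    {ρ₁ : Representation K G V₁} {σ₁ : Representation K G W₁}
    {ρ₂ : Representation K G V₂} {σ₂ : Representation K G W₂}
    (e : ρ₁.Equiv ρ₂) (f : σ₁.Equiv σ₂) : (ρ₁.prod σ₁).Equiv (ρ₂.prod σ₂) :=
  Representation.Equiv.mk (e.toLinearEquiv.prodCongr f.toLinearEquiv) (fun g => by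
    ext x <;> simp [e.isIntertwining, f.isIntertwining])

/-- Tensor products of isomorphic modules are isomorphic. -/
def tensorCongr {V₁ W₁ V₂ W₂ : Type*} [AddCommGroup V₁] [Module K V₁] [AddCommGroup W₁]
    [Module K W₁] [AddCommGroup V₂] [Module K V₂] [AddCommGroup W₂] [Module K W₂]
    {ρ₁ : Representation K G V₁} {σ₁ : Representation K G W₁}
    {ρ₂ : Representation K G V₂} {σ₂ : Representation K G W₂}
    (e : ρ₁.Equiv ρ₂) (f : σ₁.Equiv σ₂) : (ρ₁.tprod σ₁).Equiv (ρ₂.tprod σ₂) :=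
  Representation.Equiv.mk (TensorProduct.congr e.toLinearEquiv f.toLinearEquiv) (fun g => by
    ext x y; simp [e.isIntertwining, f.isIntertwining])

/-- The class of the direct sum of two modules with given classes. -/
def IsoClass.directSum (a b : IsoClass K G) : IsoClass K G :=
  Quotient.map₂ (sa := matRepSetoid K G) (sb := matRepSetoid K G) (sc := matRepSetoid K G)
    (fun A B => ⟨_, transport (A.2.prod B.2) (Module.finBasis K _).equivFun⟩)
    (fun _ _ ⟨e⟩ _ _ ⟨f⟩ =>
      ⟨((transportEquiv _ _).symm.trans (prodCongr e f)).trans (transportEquiv _ _)⟩) a b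

/-- The class of the tensor product (with diagonal action) of two modules with given classes. -/
def IsoClass.tensor (a b : IsoClass K G) : IsoClass K G :=
  Quotient.map₂ (sa := matRepSetoid K G) (sb := matRepSetoid K G) (sc := matRepSetoid K G)
    (fun A B => ⟨_, transport (A.2.tprod B.2) (Module.finBasis K _).equivFun⟩)
    (fun _ _ ⟨e⟩ _ _ ⟨f⟩ =>
      ⟨((transportEquiv _ _).symm.trans (tensorCongr e f)).trans (transportEquiv _ _)⟩) a b

theorem isoClass_prod [Module.Finite K V] [Module.Finite K W] (ρ : Representation K G V)
    (σ : Representation K G W) :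
    isoClass (ρ.prod σ) = (isoClass ρ).directSum (isoClass σ) :=
  isoClass_eq (prodCongr (transportEquiv ρ _) (transportEquiv σ _))

theorem isoClass_tprod [Module.Finite K V] [Module.Finite K W] (ρ : Representation K G V)
    (σ : Representation K G W) :
    isoClass (ρ.tprod σ) = (isoClass ρ).tensor (isoClass σ) :=
  isoClass_eq (tensorCongr (transportEquiv ρ _) (transportEquiv σ _))

theorem IsoClass.exists_rep (a : IsoClass K G) :
    ∃ A : MatRep K G, a = isoClass A.2 := by
  obtain ⟨A, rfl⟩ := Quotient.exists_rep a
  exact ⟨A, (isoClass_mk A).symm⟩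

/-- Isomorphism classes form a commutative monoid under the tensor product; the unit is the class
of the trivial module `K`. -/
instance : CommMonoid (IsoClass K G) where
  mul := IsoClass.tensor
  one := isoClass (Representation.trivial K G K)
  mul_assoc a b c := by
    obtain ⟨A, rfl⟩ := a.exists_rep
    obtain ⟨B, rfl⟩ := b.exists_rep
    obtain ⟨C, rfl⟩ := c.exists_rep
    change IsoClass.tensor (IsoClass.tensor _ _) _ = IsoClass.tensor _ (IsoClass.tensor _ _)
    rw [← isoClass_tprod, ← isoClass_tprod, ← isoClass_tprod, ← isoClass_tprod]
    exact isoClass_eq (Representation.TensorProduct.assoc _ _ _)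
  mul_comm a b := by
    obtain ⟨A, rfl⟩ := a.exists_rep
    obtain ⟨B, rfl⟩ := b.exists_rep
    change IsoClass.tensor _ _ = IsoClass.tensor _ _
    rw [← isoClass_tprod, ← isoClass_tprod]
    exact isoClass_eq (Representation.TensorProduct.comm _ _)
  one_mul a := by
    obtain ⟨A, rfl⟩ := a.exists_rep
    exact (isoClass_tprod _ _).symm.trans (isoClass_eq (Representation.TensorProduct.lid _ _))
  mul_one a := by
    obtain ⟨A, rfl⟩ := a.exists_rep
    exact (isoClass_tprod _ _).symm.trans (isoClass_eq (Representation.TensorProduct.rid _ _))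

variable (K G)

/-- The relations `[U ⊕ W] = [U] + [W]`. -/
def greenIdeal : Ideal (MonoidAlgebra ℤ (IsoClass K G)) :=
  Ideal.span {x | ∃ a b : IsoClass K G,
    x = MonoidAlgebra.of ℤ _ (a.directSum b)
      - (MonoidAlgebra.of ℤ _ a + MonoidAlgebra.of ℤ _ b)}

/-- The Green ring (representation ring): the commutative ring generated by the isomorphism
classes of finite dimensional `KG`-modules, with `[U][W] = [U ⊗ W]`, subject to
`[U ⊕ W] = [U] + [W]`. By the Krull-Schmidt theorem its additive group is free on the classes of
indecomposable modules. -/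
abbrev GreenRing : Type (max u v) := MonoidAlgebra ℤ (IsoClass K G) ⧸ greenIdeal K G

/-- The Green algebra `Γ_K(G) = ℂ ⊗ R_K(G)`. -/
abbrev GreenAlgebra : Type (max u v) := ℂ ⊗[ℤ] GreenRing K G

variable {K G}

open Classical in
/-- The class `[V]` in the Green algebra of a finite dimensional `KG`-module `V`; the value is `0`
by convention if `V` is not finite dimensional. -/
def greenClass (ρ : Representation K G V) : GreenAlgebra K G :=
  if _h : Module.Finite K V then
    1 ⊗ₜ[ℤ] Ideal.Quotient.mk (greenIdeal K G) (MonoidAlgebra.of ℤ _ (isoClass ρ))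
  else 0

end Green

/-! ### Formal series graded by `Γ × ℤ/2` and logarithmic functions -/

/-- `R[[Γ × ℤ/2]]`: formal sums `∑ f (α, a) e^(α, a)` with arbitrary coefficients in `R`. -/
def GradedSeries (S : Type*) (R : Type*) : Type _ := S × ZMod 2 → R

namespace GradedSeries

variable {S : Type*} {R : Type*} [CommRing R] [Algebra ℂ R]

instance : AddCommGroup (GradedSeries S R) := inferInstanceAs (AddCommGroup (S × ZMod 2 → R))

instance : Module ℂ (GradedSeries S R) := inferInstanceAs (Module ℂ (S × ZMod 2 → R))

/-- The product, extending `e^(α, a) e^(β, b) = e^(α + β, a + b)`. The sum runs over the ways of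
writing `γ` as a sum of two elements, of which there are finitely many for the semigroups in
use. -/
instance [Add S] : Mul (GradedSeries S R) where
  mul f g := fun γ =>
    ∑ᶠ p : {p : (S × ZMod 2) × (S × ZMod 2) // p.1 + p.2 = γ}, f p.1.1 * g p.1.2

/-- `powSucc f k = f ^ (k + 1)`. -/
def powSucc [Add S] (f : GradedSeries S R) : ℕ → GradedSeries S R
  | 0 => f
  | k + 1 => powSucc f k * f

/-- `(1 + f) ^ c - 1 = ∑_{k ≥ 1} (c (c - 1) ⋯ (c - k + 1) / k!) f ^ k`. -/
def onePlusPowSubOne [Add S] (f : GradedSeries S R) (c : ℂ) : GradedSeries S R := fun γ =>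
  ∑ᶠ k : ℕ, ((∏ i ∈ Finset.range (k + 1), (c - (i : ℂ))) / (Nat.factorial (k + 1) : ℂ)) •
    powSucc f k γ

/-- The series all of whose terms have height at least `n`. -/
def filtration (ht : S → ℤ) (n : ℕ) : Set (GradedSeries S R) :=
  {f | ∀ γ : S × ZMod 2, ht γ.1 < n → f γ = 0}

/-- Logarithmic functions on `R[[Γ × ℤ/2]]`; in the last clause `1 - (1 - f) ^ c` is written
as `-((1 + (-f)) ^ c - 1)`. -/
structure IsLogarithmic [Add S] (ht : S → ℤ) (L : GradedSeries S R → GradedSeries S R) :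
    Prop where
  map_filtration : ∀ n : ℕ, 1 ≤ n → ∀ f ∈ filtration ht n, L f ∈ filtration ht n
  map_add : ∀ f g, L f + L g = L (f + g - f * g)
  map_smul : ∀ (c : ℂ) f, c • L f = L (-(onePlusPowSubOne (-f) c))

end GradedSeries

/-- The height `∑ k_i` of `∑ k_i α_i`, for a `ℤ`-basis `(α_i)` of a free abelian group. -/
def basisHeight {ι A : Type*} [Fintype ι] [AddCommGroup A] (b : Module.Basis ι ℤ A)
    (α : A) : ℤ := ∑ i, b.repr α i

/-- The `G`-module function `[V] = ∑ [V_(α, a)] e^(α, a)` of a graded `KG`-module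
`V = ⨁ V_(α, a)`. -/
def moduleFunction {K G S : Type*} [Field K] [Group G] {V : S × ZMod 2 → Type*}
    [∀ γ, AddCommGroup (V γ)] [∀ γ, Module K (V γ)] (ρ : ∀ γ, Representation K G (V γ)) :
    GradedSeries S (Green.GreenAlgebra K G) :=
  fun γ => Green.greenClass (ρ γ)

/-! ### The free Lie superalgebra on a graded vector space -/

namespace FreeLieSuper


set_option linter.unusedSectionVars false

variable (K : Type u) [Field K] {S : Type w} [Add S] (V : S × ZMod 2 → Type x)

/-- The free nonassociative algebra on the homogeneous elements of `V = ⨁ V_(α, a)`. -/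
abbrev FreeNA := FreeNonUnitalNonAssocAlgebra K (Σ γ, V γ)

/-- A homogeneous element of `V` as a generator. -/
def gen {γ : S × ZMod 2} (v : V γ) : FreeNA K V := FreeNonUnitalNonAssocAlgebra.of K ⟨γ, v⟩

variable {V} in
/-- The degree in `Γ × ℤ/2` of a nonassociative word in the homogeneous elements of `V`. -/
def wordDeg : FreeMagma (Σ γ, V γ) → S × ZMod 2
  | .of y => y.1
  | .mul s t => wordDeg s + wordDeg t

/-- The span of the words of degree `γ`. -/
def homog (γ : S × ZMod 2) : Submodule K (FreeNA K V) :=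
  Submodule.span K {y | ∃ s : FreeMagma (Σ γ, V γ), wordDeg s = γ ∧
    y = MonoidAlgebra.single s 1}

/-- The span of the words of parity `a`. -/
def parity (a : ZMod 2) : Submodule K (FreeNA K V) :=
  Submodule.span K {y | ∃ s : FreeMagma (Σ γ, V γ), (wordDeg s).2 = a ∧
    y = MonoidAlgebra.single s 1}

variable [∀ γ, AddCommGroup (V γ)] [∀ γ, Module K (V γ)]

/-- The elements of the two-sided ideal generated by the linear relations of `V` and by the
axioms of a Lie superalgebra, with the product as bracket. -/
inductive Rel : FreeNA K V → Prop
  | gen_add {γ : S × ZMod 2} (v w : V γ) : Rel (gen K V (v + w) - (gen K V v + gen K V w))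
  | gen_smul {γ : S × ZMod 2} (c : K) (v : V γ) : Rel (gen K V (c • v) - c • gen K V v)
  | skew {a b : ZMod 2} {y z : FreeNA K V} (hy : y ∈ parity K V a) (hz : z ∈ parity K V b) :
      Rel (y * z - -((-1 : K) ^ (a.val * b.val) • (z * y)))
  | jacobi {a b c : ZMod 2} {y z t : FreeNA K V} (hy : y ∈ parity K V a)
      (hz : z ∈ parity K V b) (ht : t ∈ parity K V c) :
      Rel (y * (z * t) - ((y * z) * t + (-1 : K) ^ (a.val * b.val) • (z * (y * t))))
  | cube {y : FreeNA K V} (h3 : ringChar K = 3) (hy : y ∈ parity K V 1) : Rel (y * (y * y))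
  | zero : Rel 0
  | add {y z : FreeNA K V} : Rel y → Rel z → Rel (y + z)
  | smul (c : K) {y : FreeNA K V} : Rel y → Rel (c • y)
  | mul_left (y : FreeNA K V) {z : FreeNA K V} : Rel z → Rel (y * z)
  | mul_right {y : FreeNA K V} (z : FreeNA K V) : Rel y → Rel (y * z)

/-- The ideal of relations, as a subspace. -/
def relIdeal : Submodule K (FreeNA K V) where
  carrier := {y | Rel K V y}
  add_mem' := Rel.add
  zero_mem' := Rel.zero
  smul_mem' c _ := Rel.smul c

/-- The free Lie superalgebra `𝔏(V)` generated by the graded vector space `V`. -/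
abbrev FreeLie := FreeNA K V ⧸ relIdeal K V

/-- The bracket of `𝔏(V)`. -/
def bracket : FreeLie K V →ₗ[K] FreeLie K V →ₗ[K] FreeLie K V :=
  (relIdeal K V).liftQ
    { toFun := fun y => (relIdeal K V).mapQ (relIdeal K V) (LinearMap.mulLeft K y)
        (fun _ hz => Rel.mul_left y hz)
      map_add' := fun y z => Submodule.linearMap_qext _ (LinearMap.ext fun t =>
        congrArg (relIdeal K V).mkQ (add_mul y z t))
      map_smul' := fun c y => Submodule.linearMap_qext _ (LinearMap.ext fun t =>
        congrArg (relIdeal K V).mkQ (smul_mul_assoc c y t)) }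
    (fun y hy => Submodule.linearMap_qext _ (LinearMap.ext fun t =>
      (Submodule.Quotient.mk_eq_zero (relIdeal K V) (x := y * t)).2 (Rel.mul_right t hy)))

/-- The homogeneous component `𝔏(V)_γ`, for `γ` in `Γ × ℤ/2`. -/
def component (γ : S × ZMod 2) : Submodule K (FreeLie K V) :=
  (homog K V γ).map (relIdeal K V).mkQ

variable {K V} {G : Type v} [Group G] (ρ : ∀ γ, Representation K G (V γ))

/-- The action of a group element on the free nonassociative algebra, by algebra
endomorphisms. -/
def actNA (g : G) : FreeNA K V →ₙₐ[K] FreeNA K V :=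
  FreeNonUnitalNonAssocAlgebra.lift K (fun y => gen K V (ρ y.1 g y.2))

/-- The action of a group element on words. -/
def actWord (g : G) : FreeMagma (Σ γ, V γ) → FreeMagma (Σ γ, V γ)
  | .of y => .of ⟨y.1, ρ y.1 g y.2⟩
  | .mul s t => .mul (actWord g s) (actWord g t)

theorem wordDeg_actWord (g : G) (s : FreeMagma (Σ γ, V γ)) :
    wordDeg (actWord ρ g s) = wordDeg s := by
  induction s with
  | ih1 y => rfl
  | ih2 s t hs ht =>
    change wordDeg (actWord ρ g s) + wordDeg (actWord ρ g t) = wordDeg s + wordDeg t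
    rw [hs, ht]

theorem actNA_gen (g : G) {γ : S × ZMod 2} (v : V γ) :
    actNA ρ g (gen K V v) = gen K V (ρ γ g v) :=
  FreeNonUnitalNonAssocAlgebra.lift_of_apply K _ _

theorem single_mul_word (s t : FreeMagma (Σ γ, V γ)) :
    (MonoidAlgebra.single (FreeMagma.mul s t) 1 : FreeNA K V)
      = MonoidAlgebra.single s 1 * MonoidAlgebra.single t 1 := by
  rw [MonoidAlgebra.single_mul_single, one_mul]; rfl

theorem actNA_single (g : G) (s : FreeMagma (Σ γ, V γ)) :
    actNA ρ g (MonoidAlgebra.single s 1) = MonoidAlgebra.single (actWord ρ g s) 1 := by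
  induction s with
  | ih1 y => exact actNA_gen ρ g y.2
  | ih2 s t hs ht =>
    change actNA ρ g (MonoidAlgebra.single (FreeMagma.mul s t) 1)
      = MonoidAlgebra.single (FreeMagma.mul (actWord ρ g s) (actWord ρ g t)) 1
    rw [single_mul_word, single_mul_word, map_mul, hs, ht]

theorem actNA_parity (g : G) {a : ZMod 2} {y : FreeNA K V} (hy : y ∈ parity K V a) :
    actNA ρ g y ∈ parity K V a := by
  induction hy using Submodule.span_induction with
  | mem y hy =>
    obtain ⟨s, hs, rfl⟩ := hy
    rw [actNA_single]
    exact Submodule.subset_span ⟨_, by rw [wordDeg_actWord, hs], rfl⟩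
  | zero => rw [map_zero]; exact Submodule.zero_mem _
  | add y z _ _ h1 h2 => rw [map_add]; exact Submodule.add_mem _ h1 h2
  | smul c y _ h => rw [map_smul]; exact Submodule.smul_mem _ c h

theorem actNA_homog (g : G) {γ : S × ZMod 2} {y : FreeNA K V} (hy : y ∈ homog K V γ) :
    actNA ρ g y ∈ homog K V γ := by
  induction hy using Submodule.span_induction with
  | mem y hy =>
    obtain ⟨s, hs, rfl⟩ := hy
    rw [actNA_single]
    exact Submodule.subset_span ⟨_, by rw [wordDeg_actWord, hs], rfl⟩
  | zero => rw [map_zero]; exact Submodule.zero_mem _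
  | add y z _ _ h1 h2 => rw [map_add]; exact Submodule.add_mem _ h1 h2
  | smul c y _ h => rw [map_smul]; exact Submodule.smul_mem _ c h

theorem actNA_rel (g : G) {y : FreeNA K V} (hy : Rel K V y) : Rel K V (actNA ρ g y) := by
  induction hy with
  | gen_add v w => simpa [actNA_gen] using Rel.gen_add (K := K) (ρ _ g v) (ρ _ g w)
  | gen_smul c v => simpa [actNA_gen] using Rel.gen_smul (K := K) c (ρ _ g v)
  | skew hy hz =>
    rw [map_sub, map_neg, map_smul, map_mul, map_mul]
    exact Rel.skew (actNA_parity ρ g hy) (actNA_parity ρ g hz)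
  | jacobi hy hz ht =>
    rw [map_sub, map_add, map_smul, map_mul, map_mul, map_mul, map_mul, map_mul, map_mul]
    exact Rel.jacobi (actNA_parity ρ g hy) (actNA_parity ρ g hz) (actNA_parity ρ g ht)
  | cube h3 hy =>
    rw [map_mul, map_mul]
    exact Rel.cube h3 (actNA_parity ρ g hy)
  | zero => rw [map_zero]; exact Rel.zero
  | add _ _ h1 h2 => rw [map_add]; exact Rel.add h1 h2
  | smul c _ h => rw [map_smul]; exact Rel.smul c h
  | mul_left y _ h => rw [map_mul]; exact Rel.mul_left _ h
  | mul_right z _ h => rw [map_mul]; exact Rel.mul_right _ h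

theorem actNA_one : actNA ρ (1 : G) = NonUnitalAlgHom.id K (FreeNA K V) := by
  refine FreeNonUnitalNonAssocAlgebra.hom_ext K fun y => ?_
  change actNA ρ 1 (gen K V y.2) = gen K V y.2
  rw [actNA_gen]; simp

theorem actNA_mul (g h : G) : actNA ρ (g * h) = (actNA ρ g).comp (actNA ρ h) := by
  refine FreeNonUnitalNonAssocAlgebra.hom_ext K fun y => ?_
  change actNA ρ (g * h) (gen K V y.2) = actNA ρ g (actNA ρ h (gen K V y.2))
  rw [actNA_gen, actNA_gen, actNA_gen]; simp

/-- The action of `G` on `𝔏(V)` by Lie superalgebra automorphisms, extending the action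
on `V`. -/
def rep : Representation K G (FreeLie K V) where
  toFun g := (relIdeal K V).mapQ (relIdeal K V) (actNA ρ g : FreeNA K V →ₗ[K] FreeNA K V)
    (fun _ hy => actNA_rel ρ g hy)
  map_one' := by
    refine Submodule.linearMap_qext _ (LinearMap.ext fun t => ?_)
    simp [actNA_one]
  map_mul' g h := by
    refine Submodule.linearMap_qext _ (LinearMap.ext fun t => ?_)
    exact congrArg (relIdeal K V).mkQ (congrArg (fun F => F t) (actNA_mul ρ g h))

/-- The `KG`-module `𝔏(V)_γ`. -/
def componentRep (γ : S × ZMod 2) : Representation K G (component K V γ) :=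
  (rep ρ).subrepresentation (component K V γ) (fun g => by
    rintro _ ⟨y, hy, rfl⟩
    exact ⟨actNA ρ g y, actNA_homog ρ g hy, rfl⟩)

end FreeLieSuper

end

/-!
The argument rests on Lazard elimination, which holds over every field and needs neither bases of
free Lie superalgebras nor a Poincaré-Birkhoff-Witt theorem. Let `U` and `V` be graded modules and let
`W` be the free left module generated by `V` over the tensor algebra of `U`. Then
`𝔏(U ⊕ V) ≅ 𝔏(U) ⊕ 𝔏(W)` as graded `KG`-modules (`FreeLieSuper.elimination`). The two images span
because the image of `𝔏(W)` is stable under brackets with `𝔏(U)`. The sum is direct because left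
multiplication by `U` on `W` extends to superderivations of `𝔏(W)`, which gives a homomorphism from
`𝔏(U ⊕ V)` to the semidirect product of these with `𝔏(W)`. In classes,
`[𝔏(U ⊕ V)] = [𝔏(U)] + [𝔏(W)]` where `(1 - [U]) (1 - [W]) = 1 - [U ⊕ V]`, which is the law that a
logarithmic function has to satisfy (`Green.exists_elimination`).

Logarithmic functions are the maps `f ↦ Λ (-log (1 - f))` with `Λ` linear. The logarithm
(`GradedSeries.negLog`) is obtained by integrating `θ(f) / (1 - f)`, where `θ` is the Euler derivation
that multiplies terms by their height; this reduces its functional equations to the differential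
equation of the binomial series. For existence, a functional `Λ` is constructed for each coefficient
of `[𝔏(V)]` separately, by descending induction on the height from which on `V` is supported
(`Green.exists_correction`): on the terms `A e ^ γ` of a new height, `Λ` has to be corrected by a
function of the module `A`. By elimination this function is additive in `A`, so that it extends to the
Green algebra by the defining relations of the latter, without recourse to the Krull-Schmidt theorem.

For uniqueness, every series is, up to series of arbitrarily large height, obtained from classes of
modules by the operations `f + g - f g` and `1 - (1 - f) ^ c`, and these determine the values of a
logarithmic function (`Green.isLogarithmic_unique`).
-/

noncomputable section

/-! ### The universal property of the free Lie superalgebra -/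

namespace FreeLieSuper

section UniversalProperty

set_option linter.unusedSectionVars false

/-- The Koszul sign `(-1) ^ (ab)`. -/
def koszul (K : Type*) [Field K] (a b : ZMod 2) : K := (-1) ^ (a.val * b.val)

theorem koszul_comm (K : Type*) [Field K] (a b : ZMod 2) : koszul K a b = koszul K b a := by
  rw [koszul, koszul, mul_comm]

theorem koszul_mul_self (K : Type*) [Field K] (a b : ZMod 2) :
    koszul K a b * koszul K a b = 1 := by
  rw [koszul, ← mul_pow]; simp

theorem koszul_add_left (K : Type*) [Field K] (a b c : ZMod 2) :
    koszul K (a + b) c = koszul K a c * koszul K b c := by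
  rw [koszul, koszul, koszul, ← pow_add, ← add_mul, neg_one_pow_eq_pow_mod_two,
    neg_one_pow_eq_pow_mod_two (n := (a.val + b.val) * c.val)]
  congr 1
  rw [ZMod.val_add, Nat.mul_mod, Nat.mod_mod, ← Nat.mul_mod]

theorem koszul_add_right (K : Type*) [Field K] (a b c : ZMod 2) :
    koszul K a (b + c) = koszul K a b * koszul K a c := by
  rw [koszul_comm, koszul_add_left, koszul_comm, koszul_comm K c]

@[simp] theorem koszul_one_one (K : Type*) [Field K] : koszul K 1 1 = -1 := by
  simp [koszul, ZMod.val_one]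

variable {K : Type u} [Field K] {S : Type w} [Add S] {V : S × ZMod 2 → Type x}
  [∀ γ, AddCommGroup (V γ)] [∀ γ, Module K (V γ)]

variable (K V) in
/-- The inclusion of the generators of degree `γ`. -/
def ι (γ : S × ZMod 2) : V γ →ₗ[K] FreeLie K V where
  toFun v := (relIdeal K V).mkQ (gen K V v)
  map_add' v w := by
    rw [← map_add, Submodule.mkQ_apply, Submodule.mkQ_apply, Submodule.Quotient.eq]
    exact Rel.gen_add v w
  map_smul' c v := by
    rw [← map_smul, Submodule.mkQ_apply, Submodule.mkQ_apply, Submodule.Quotient.eq]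
    exact Rel.gen_smul c v

variable (K V) in
/-- The subspace of elements of parity `a`. -/
def lieParity (a : ZMod 2) : Submodule K (FreeLie K V) := (parity K V a).map (relIdeal K V).mkQ

theorem bracket_mkQ (y z : FreeNA K V) :
    bracket K V ((relIdeal K V).mkQ y) ((relIdeal K V).mkQ z) = (relIdeal K V).mkQ (y * z) :=
  rfl

/-- Brackets `β a b` on a space `N`, one for each pair of parities, that satisfy the axioms of a
Lie superalgebra on the subspaces `Q a` of elements of parity `a`. Letting the bracket depend on
the parities allows for formulas with signs without decomposing elements into their even and odd
parts. -/
structure IsSuperBracket {N : Type*} [AddCommGroup N] [Module K N]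
    (β : ZMod 2 → ZMod 2 → N →ₗ[K] N →ₗ[K] N) (Q : ZMod 2 → Submodule K N) : Prop where
  mem : ∀ {a b y z}, y ∈ Q a → z ∈ Q b → β a b y z ∈ Q (a + b)
  skew : ∀ {a b y z}, y ∈ Q a → z ∈ Q b → β a b y z = -(koszul K a b • β b a z y)
  jacobi : ∀ {a b c y z t}, y ∈ Q a → z ∈ Q b → t ∈ Q c →
    β a (b + c) y (β b c z t)
      = β (a + b) c (β a b y z) t + koszul K a b • β b (a + c) z (β a c y t)
  cube : ∀ {y}, ringChar K = 3 → y ∈ Q 1 → β 1 (1 + 1) y (β 1 1 y y) = 0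

/-- An induction over words: a family of subspaces, indexed by degrees and compatible with
brackets, that contains the generators contains the components. -/
theorem mkQ_word_mem (Q : S × ZMod 2 → Submodule K (FreeLie K V))
    (hgen : ∀ γ v, ι K V γ v ∈ Q γ)
    (hmul : ∀ α β y z, y ∈ Q α → y ∈ component K V α → z ∈ Q β → z ∈ component K V β →
      bracket K V y z ∈ Q (α + β))
    (s : FreeMagma (Σ γ, V γ)) :
    (relIdeal K V).mkQ (MonoidAlgebra.single s 1) ∈ Q (wordDeg s) ∧
      (relIdeal K V).mkQ (MonoidAlgebra.single s 1) ∈ component K V (wordDeg s) := by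
  have hc (s : FreeMagma (Σ γ, V γ)) :
      (relIdeal K V).mkQ (MonoidAlgebra.single s 1) ∈ component K V (wordDeg s) :=
    Submodule.mem_map_of_mem (Submodule.subset_span ⟨s, rfl, rfl⟩)
  refine ⟨?_, hc s⟩
  induction s with
  | ih1 y => exact hgen y.1 y.2
  | ih2 s t hs ht =>
    have := hmul _ _ _ _ hs (hc s) ht (hc t)
    rw [bracket_mkQ, ← single_mul_word] at this
    exact this

theorem component_le (Q : S × ZMod 2 → Submodule K (FreeLie K V))
    (hgen : ∀ γ v, ι K V γ v ∈ Q γ)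
    (hmul : ∀ α β y z, y ∈ Q α → y ∈ component K V α → z ∈ Q β → z ∈ component K V β →
      bracket K V y z ∈ Q (α + β)) (γ : S × ZMod 2) : component K V γ ≤ Q γ := by
  rw [component, homog, Submodule.map_span, Submodule.span_le]
  rintro _ ⟨_, ⟨s, rfl, rfl⟩, rfl⟩
  exact (mkQ_word_mem Q hgen hmul s).1

/-- If every component lies in `N`, then `N` is everything. -/
theorem mem_of_component_le (N : Submodule K (FreeLie K V)) (h : ∀ γ, component K V γ ≤ N)
    (y : FreeLie K V) : y ∈ N := by
  obtain ⟨y, rfl⟩ := (relIdeal K V).mkQ_surjective y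
  induction y using MonoidAlgebra.induction_linear with
  | zero => rw [map_zero]; exact N.zero_mem
  | add y z hy hz => rw [map_add]; exact N.add_mem hy hz
  | single s c =>
    have : (MonoidAlgebra.single s c : FreeNA K V) = c • MonoidAlgebra.single s 1 := by
      rw [MonoidAlgebra.smul_single, smul_eq_mul, mul_one]
    rw [this, map_smul]
    exact N.smul_mem _ (h (wordDeg s)
      (Submodule.mem_map_of_mem (Submodule.subset_span ⟨s, rfl, rfl⟩)))

theorem component_le_lieParity (γ : S × ZMod 2) : component K V γ ≤ lieParity K V γ.2 := by
  rw [component, homog, Submodule.map_span, Submodule.span_le]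
  rintro _ ⟨_, ⟨s, rfl, rfl⟩, rfl⟩
  exact Submodule.mem_map_of_mem (Submodule.subset_span ⟨s, rfl, rfl⟩)

theorem ι_mem_component (γ : S × ZMod 2) (v : V γ) : ι K V γ v ∈ component K V γ :=
  Submodule.mem_map_of_mem (Submodule.subset_span ⟨.of ⟨γ, v⟩, rfl, rfl⟩)

theorem ι_mem_lieParity (γ : S × ZMod 2) (v : V γ) : ι K V γ v ∈ lieParity K V γ.2 :=
  component_le_lieParity γ (ι_mem_component γ v)

theorem homog_mul_mem {α β : S × ZMod 2} {y z : FreeNA K V} (hy : y ∈ homog K V α)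
    (hz : z ∈ homog K V β) : y * z ∈ homog K V (α + β) := by
  induction hy using Submodule.span_induction with
  | mem y hy =>
    obtain ⟨s, rfl, rfl⟩ := hy
    induction hz using Submodule.span_induction with
    | mem z hz =>
      obtain ⟨t, rfl, rfl⟩ := hz
      rw [← single_mul_word]
      exact Submodule.subset_span ⟨_, rfl, rfl⟩
    | zero => rw [mul_zero]; exact Submodule.zero_mem _
    | add y z _ _ h1 h2 => rw [mul_add]; exact Submodule.add_mem _ h1 h2
    | smul c y _ h => rw [mul_smul_comm]; exact Submodule.smul_mem _ c h
  | zero => rw [zero_mul]; exact Submodule.zero_mem _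
  | add y z _ _ h1 h2 => rw [add_mul]; exact Submodule.add_mem _ h1 h2
  | smul c y _ h => rw [smul_mul_assoc]; exact Submodule.smul_mem _ c h

theorem bracket_mem_component {α β : S × ZMod 2} {y z : FreeLie K V}
    (hy : y ∈ component K V α) (hz : z ∈ component K V β) :
    bracket K V y z ∈ component K V (α + β) := by
  obtain ⟨y, hy, rfl⟩ := hy
  obtain ⟨z, hz, rfl⟩ := hz
  exact ⟨y * z, homog_mul_mem hy hz, rfl⟩

theorem parity_mul_mem {a b : ZMod 2} {y z : FreeNA K V} (hy : y ∈ parity K V a)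
    (hz : z ∈ parity K V b) : y * z ∈ parity K V (a + b) := by
  induction hy using Submodule.span_induction with
  | mem y hy =>
    obtain ⟨s, rfl, rfl⟩ := hy
    induction hz using Submodule.span_induction with
    | mem z hz =>
      obtain ⟨t, rfl, rfl⟩ := hz
      rw [← single_mul_word]
      exact Submodule.subset_span ⟨_, rfl, rfl⟩
    | zero => rw [mul_zero]; exact Submodule.zero_mem _
    | add y z _ _ h1 h2 => rw [mul_add]; exact Submodule.add_mem _ h1 h2
    | smul c y _ h => rw [mul_smul_comm]; exact Submodule.smul_mem _ c h
  | zero => rw [zero_mul]; exact Submodule.zero_mem _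
  | add y z _ _ h1 h2 => rw [add_mul]; exact Submodule.add_mem _ h1 h2
  | smul c y _ h => rw [smul_mul_assoc]; exact Submodule.smul_mem _ c h

variable (K V) in
/-- The free Lie superalgebra satisfies the axioms of a Lie superalgebra. -/
theorem isSuperBracket_bracket :
    IsSuperBracket (fun _ _ => bracket K V) (lieParity K V) where
  mem := by
    rintro a b _ _ ⟨y, hy, rfl⟩ ⟨z, hz, rfl⟩
    exact ⟨y * z, parity_mul_mem hy hz, rfl⟩
  skew := by
    rintro a b _ _ ⟨y, hy, rfl⟩ ⟨z, hz, rfl⟩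
    rw [bracket_mkQ, bracket_mkQ, ← map_smul, ← map_neg, Submodule.mkQ_apply,
      Submodule.mkQ_apply, Submodule.Quotient.eq]
    exact Rel.skew hy hz
  jacobi := by
    rintro a b c _ _ _ ⟨y, hy, rfl⟩ ⟨z, hz, rfl⟩ ⟨t, ht, rfl⟩
    rw [bracket_mkQ, bracket_mkQ, bracket_mkQ, bracket_mkQ, bracket_mkQ, bracket_mkQ,
      ← map_smul, ← map_add, Submodule.mkQ_apply, Submodule.mkQ_apply, Submodule.Quotient.eq]
    exact Rel.jacobi hy hz ht
  cube := by
    rintro _ h3 ⟨y, hy, rfl⟩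
    rw [bracket_mkQ, bracket_mkQ, Submodule.mkQ_apply, Submodule.Quotient.mk_eq_zero]
    exact Rel.cube h3 hy

/-- A bilinear map on `N` extends to a homomorphism from the free nonassociative algebra. -/
theorem exists_lift_freeNA {N : Type*} [AddCommGroup N] [Module K N] (B : N →ₗ[K] N →ₗ[K] N)
    (f : ∀ γ, V γ → N) : ∃ F : FreeNA K V →ₗ[K] N,
      (∀ γ v, F (gen K V (γ := γ) v) = f γ v) ∧ ∀ y z, F (y * z) = B (F y) (F z) := by
  let _ : NonUnitalNonAssocRing N :=
    { (inferInstance : AddCommGroup N) with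
      mul := fun y z => B y z
      left_distrib := fun y z t => map_add (B y) z t
      right_distrib := fun y z t => by
        change B (y + z) t = B y t + B z t
        rw [map_add, LinearMap.add_apply]
      zero_mul := fun y => by change B 0 y = 0; rw [map_zero, LinearMap.zero_apply]
      mul_zero := fun y => map_zero (B y) }
  have : IsScalarTower K N N := ⟨fun c y z => by
    change B (c • y) z = c • B y z
    rw [map_smul, LinearMap.smul_apply]⟩
  have : SMulCommClass K N N := ⟨fun c y z => by
    change c • B y z = B y (c • z)
    rw [map_smul]⟩
  let F : FreeNA K V →ₙₐ[K] N := FreeNonUnitalNonAssocAlgebra.lift K (fun y => f y.1 y.2)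
  refine ⟨(F : FreeNA K V →ₗ[K] N), fun γ v => ?_, fun y z => map_mul F y z⟩
  exact FreeNonUnitalNonAssocAlgebra.lift_of_apply K _ _

/-- The universal property of the free Lie superalgebra. -/
theorem exists_lift {N : Type*} [AddCommGroup N] [Module K N]
    {β : ZMod 2 → ZMod 2 → N →ₗ[K] N →ₗ[K] N} {Q : ZMod 2 → Submodule K N}
    (h : IsSuperBracket β Q) (f : ∀ γ, V γ →ₗ[K] N) (hf : ∀ γ v, f γ v ∈ Q γ.2) :
    ∃ F : FreeLie K V →ₗ[K] N, (∀ γ v, F (ι K V γ v) = f γ v) ∧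
      (∀ a y, y ∈ lieParity K V a → F y ∈ Q a) ∧
      ∀ a b y z, y ∈ lieParity K V a → z ∈ lieParity K V b →
        F (bracket K V y z) = β a b (F y) (F z) := by
  -- the bilinear bracket on the sum of two copies of `N`, one for each parity
  let B : (ZMod 2 → N) →ₗ[K] (ZMod 2 → N) →ₗ[K] (ZMod 2 → N) :=
    ∑ a, ∑ b, (((β a b).compl₁₂ (LinearMap.proj a) (LinearMap.proj b)).compr₂
      (LinearMap.single K (fun _ => N) (a + b)))
  have hB (a b : ZMod 2) (y z : N) :
      B (Pi.single a y) (Pi.single b z) = Pi.single (a + b) (β a b y z) := by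
    simp only [B, LinearMap.sum_apply, LinearMap.compr₂_apply, LinearMap.compl₁₂_apply,
      LinearMap.proj_apply, LinearMap.single_apply]
    rw [Finset.sum_eq_single a, Finset.sum_eq_single b]
    · simp
    · intro c _ hc; simp [hc]
    · simp
    · intro c _ hc
      refine Finset.sum_eq_zero fun d _ => ?_
      simp [hc]
    · simp
  obtain ⟨F, hFg, hFm⟩ := exists_lift_freeNA B
    (fun γ (v : V γ) => (Pi.single γ.2 (f γ v) : ZMod 2 → N))
  have hFw (s : FreeMagma (Σ γ, V γ)) :
      ∃ n ∈ Q (wordDeg s).2, F (MonoidAlgebra.single s 1) = Pi.single (wordDeg s).2 n := by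
    induction s with
    | ih1 y => exact ⟨f y.1 y.2, hf _ _, hFg y.1 y.2⟩
    | ih2 s t hs ht =>
      obtain ⟨n, hn, hs⟩ := hs
      obtain ⟨m, hm, ht⟩ := ht
      refine ⟨_, h.mem hn hm, ?_⟩
      change F (MonoidAlgebra.single (FreeMagma.mul s t) 1) = Pi.single (_ + _) _
      rw [single_mul_word, hFm, hs, ht, hB]
  have hFp (a : ZMod 2) (y : FreeNA K V) (hy : y ∈ parity K V a) :
      ∃ n ∈ Q a, F y = Pi.single a n := by
    induction hy using Submodule.span_induction with
    | mem y hy =>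
      obtain ⟨s, rfl, rfl⟩ := hy
      exact hFw s
    | zero => exact ⟨0, (Q a).zero_mem, by simp⟩
    | add y z _ _ h1 h2 =>
      obtain ⟨n, hn, h1⟩ := h1
      obtain ⟨m, hm, h2⟩ := h2
      exact ⟨n + m, (Q a).add_mem hn hm, by rw [map_add, h1, h2, Pi.single_add]⟩
    | smul c y _ h1 =>
      obtain ⟨n, hn, h1⟩ := h1
      exact ⟨c • n, (Q a).smul_mem c hn, by rw [map_smul, h1, Pi.single_smul]⟩
  have hFr (y : FreeNA K V) (hy : Rel K V y) : F y = 0 := by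
    induction hy with
    | gen_add v w => simp [hFg, Pi.single_add]
    | gen_smul c v => simp [hFg, Pi.single_smul]
    | @skew a b y z hy hz =>
      obtain ⟨n, hn, hy⟩ := hFp _ _ hy
      obtain ⟨m, hm, hz⟩ := hFp _ _ hz
      rw [map_sub, map_neg, map_smul, hFm, hFm, hy, hz, hB, hB, h.skew hn hm, add_comm b a,
        Pi.single_neg, Pi.single_smul]
      exact sub_self _
    | @jacobi a b c y z t hy hz ht =>
      obtain ⟨n, hn, hy⟩ := hFp _ _ hy
      obtain ⟨m, hm, hz⟩ := hFp _ _ hz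
      obtain ⟨k, hk, ht⟩ := hFp _ _ ht
      rw [map_sub, map_add, map_smul]
      simp only [hFm, hy, hz, ht, hB]
      rw [h.jacobi hn hm hk, Pi.single_add, Pi.single_smul, add_left_comm b a c, add_assoc a b c]
      exact sub_self _
    | cube h3 hy =>
      obtain ⟨n, hn, hy⟩ := hFp _ _ hy
      rw [hFm, hFm, hy, hB, hB, h.cube h3 hn, Pi.single_zero]
    | zero => exact map_zero F
    | add _ _ h1 h2 => rw [map_add, h1, h2, add_zero]
    | smul c _ h1 => rw [map_smul, h1, smul_zero]
    | mul_left y _ h1 => rw [hFm, h1, map_zero]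
    | mul_right z _ h1 => rw [hFm, h1, map_zero, LinearMap.zero_apply]
  -- forget which copy of `N` a value lies in
  let T : (ZMod 2 → N) →ₗ[K] N := ∑ a, LinearMap.proj a
  have hT (a : ZMod 2) (n : N) : T (Pi.single a n) = n := by
    simp only [T, LinearMap.sum_apply, LinearMap.proj_apply]
    rw [Finset.sum_eq_single a] <;> simp +contextual
  refine ⟨T ∘ₗ (relIdeal K V).liftQ F (fun y hy => hFr y hy), fun γ v => ?_, ?_, ?_⟩
  · change T (F (gen K V v)) = _
    rw [hFg, hT]
  · rintro a _ ⟨y, hy, rfl⟩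
    obtain ⟨n, hn, hy⟩ := hFp _ _ hy
    change T (F y) ∈ Q a
    rwa [hy, hT]
  · rintro a b _ _ ⟨y, hy, rfl⟩ ⟨z, hz, rfl⟩
    obtain ⟨n, hn, hy⟩ := hFp _ _ hy
    obtain ⟨m, hm, hz⟩ := hFp _ _ hz
    change T (F (y * z)) = β a b (T (F y)) (T (F z))
    rw [hFm, hy, hz, hB, hT, hT, hT]

theorem mem_of_lieParity_le (N : Submodule K (FreeLie K V)) (h : ∀ a, lieParity K V a ≤ N)
    (y : FreeLie K V) : y ∈ N :=
  mem_of_component_le N (fun γ => (component_le_lieParity γ).trans (h γ.2)) y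

/-- Homomorphisms between free Lie superalgebras that preserve degrees. -/
theorem exists_hom {V' : S × ZMod 2 → Type*} [∀ γ, AddCommGroup (V' γ)]
    [∀ γ, Module K (V' γ)] (f : ∀ γ, V γ →ₗ[K] FreeLie K V')
    (hf : ∀ γ v, f γ v ∈ component K V' γ) :
    ∃ F : FreeLie K V →ₗ[K] FreeLie K V', (∀ γ v, F (ι K V γ v) = f γ v) ∧
      (∀ y z, F (bracket K V y z) = bracket K V' (F y) (F z)) ∧
      ∀ γ, ∀ y ∈ component K V γ, F y ∈ component K V' γ := by
  obtain ⟨F, hFg, -, hFm⟩ := exists_lift (isSuperBracket_bracket K V') f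
    (fun γ v => component_le_lieParity γ (hf γ v))
  have hm (y z) : F (bracket K V y z) = bracket K V' (F y) (F z) := by
    have hy := mem_of_lieParity_le
      (LinearMap.eqLocus (F ∘ₗ (bracket K V).flip z) ((bracket K V').flip (F z) ∘ₗ F)) ?_ y
    · exact hy
    intro a y hy
    have hz := mem_of_lieParity_le
      (LinearMap.eqLocus (F ∘ₗ bracket K V y) (bracket K V' (F y) ∘ₗ F)) ?_ z
    · exact hz
    intro b z hz
    exact hFm a b y z hy hz
  refine ⟨F, hFg, hm, fun γ => ?_⟩
  refine component_le (fun γ => (component K V' γ).comap F) (fun γ v => ?_) ?_ γ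
  · rw [Submodule.mem_comap, hFg]; exact hf γ v
  · intro α β y z hy _ hz _
    rw [Submodule.mem_comap, hm]
    exact bracket_mem_component hy hz

/-- Two linear maps that agree on the generators and behave in the same way on brackets are
equal. -/
theorem hom_ext_of_bracket {N : Type*} [AddCommGroup N] [Module K N]
    {F F' : FreeLie K V →ₗ[K] N} (hg : ∀ γ v, F (ι K V γ v) = F' (ι K V γ v))
    (hm : ∀ α β y z, y ∈ component K V α → z ∈ component K V β → F y = F' y → F z = F' z →
      F (bracket K V y z) = F' (bracket K V y z)) : F = F' := by
  refine LinearMap.ext fun y => mem_of_component_le (LinearMap.eqLocus F F') ?_ y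
  exact component_le (fun _ => LinearMap.eqLocus F F') hg
    (fun α β y z h1 h2 h3 h4 => hm α β y z h2 h4 h1 h3)

end UniversalProperty

end FreeLieSuper

end

noncomputable section

/-! ### Functoriality and finiteness -/

namespace FreeLieSuper

section Functoriality

set_option linter.unusedSectionVars false

variable {K : Type u} [Field K] {S : Type w} [Add S] {V : S × ZMod 2 → Type x}
  [∀ γ, AddCommGroup (V γ)] [∀ γ, Module K (V γ)] {V' : S × ZMod 2 → Type*}
  [∀ γ, AddCommGroup (V' γ)] [∀ γ, Module K (V' γ)] {G : Type v} [Group G]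

theorem rep_ι (ρ : ∀ γ, Representation K G (V γ)) (g : G) (γ : S × ZMod 2) (v : V γ) :
    rep ρ g (ι K V γ v) = ι K V γ (ρ γ g v) :=
  congrArg (relIdeal K V).mkQ (actNA_gen ρ g v)

theorem rep_bracket (ρ : ∀ γ, Representation K G (V γ)) (g : G) (y z : FreeLie K V) :
    rep ρ g (bracket K V y z) = bracket K V (rep ρ g y) (rep ρ g z) := by
  obtain ⟨y, rfl⟩ := (relIdeal K V).mkQ_surjective y
  obtain ⟨z, rfl⟩ := (relIdeal K V).mkQ_surjective z
  exact congrArg (relIdeal K V).mkQ (map_mul (actNA ρ g) y z)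

/-- A homomorphism of free Lie superalgebras is `G`-equivariant if it is so on generators. -/
theorem hom_rep {ρ : ∀ γ, Representation K G (V γ)} {ρ' : ∀ γ, Representation K G (V' γ)}
    {F : FreeLie K V →ₗ[K] FreeLie K V'}
    (hF : ∀ y z, F (bracket K V y z) = bracket K V' (F y) (F z)) (g : G)
    (hg : ∀ γ v, F (ι K V γ (ρ γ g v)) = rep ρ' g (F (ι K V γ v))) (y : FreeLie K V) :
    F (rep ρ g y) = rep ρ' g (F y) := by
  refine LinearMap.congr_fun (f := F ∘ₗ rep ρ g) (g := rep ρ' g ∘ₗ F)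
    (hom_ext_of_bracket (fun γ v => ?_) fun α β y z _ _ hy hz => ?_) y
  · rw [LinearMap.comp_apply, LinearMap.comp_apply, rep_ι, hg]
  · simp only [LinearMap.comp_apply] at hy hz ⊢
    rw [rep_bracket, hF, hF, rep_bracket, hy, hz]

/-- Isomorphic graded modules have isomorphic free Lie superalgebras. -/
theorem componentRep_congr {ρ : ∀ γ, Representation K G (V γ)}
    {ρ' : ∀ γ, Representation K G (V' γ)} (e : ∀ γ, (ρ γ).Equiv (ρ' γ)) (γ : S × ZMod 2) :
    Nonempty ((componentRep ρ γ).Equiv (componentRep ρ' γ)) := by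
  obtain ⟨F, hFg, hFm, hFc⟩ := exists_hom (K := K) (V := V) (V' := V')
    (fun γ => ι K V' γ ∘ₗ (e γ).toLinearEquiv.toLinearMap) (fun γ v => ι_mem_component _ _)
  obtain ⟨F', hFg', hFm', hFc'⟩ := exists_hom (K := K) (V := V') (V' := V)
    (fun γ => ι K V γ ∘ₗ (e γ).toLinearEquiv.symm.toLinearMap) (fun γ v => ι_mem_component _ _)
  have h1 : F' ∘ₗ F = LinearMap.id := hom_ext_of_bracket
    (fun γ v => by
      rw [LinearMap.comp_apply, hFg, LinearMap.comp_apply, hFg']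
      exact congrArg (ι K V γ) ((e γ).toLinearEquiv.symm_apply_apply v))
    (fun α β y z _ _ hy hz => by
      simp only [LinearMap.comp_apply, LinearMap.id_apply] at hy hz ⊢
      rw [hFm, hFm', hy, hz])
  have h2 : F ∘ₗ F' = LinearMap.id := hom_ext_of_bracket
    (fun γ v => by
      rw [LinearMap.comp_apply, hFg', LinearMap.comp_apply, hFg]
      exact congrArg (ι K V' γ) ((e γ).toLinearEquiv.apply_symm_apply v))
    (fun α β y z _ _ hy hz => by
      simp only [LinearMap.comp_apply, LinearMap.id_apply] at hy hz ⊢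
      rw [hFm', hFm, hy, hz])
  have heq (g : G) (y : FreeLie K V) : F (rep ρ g y) = rep ρ' g (F y) := by
    refine hom_rep hFm g (fun γ v => ?_) y
    rw [hFg, hFg, LinearMap.comp_apply, LinearMap.comp_apply, rep_ι]
    exact congrArg _ (LinearMap.congr_fun ((e γ).isIntertwining' g) v)
  refine ⟨Representation.Equiv.mk (LinearEquiv.ofLinearMap (F.restrict (hFc γ))
    (F'.restrict (hFc' γ)) ?_ ?_) fun g => ?_⟩
  · ext y; exact LinearMap.congr_fun h2 y
  · ext y; exact LinearMap.congr_fun h1 y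
  · ext y; exact heq g y

end Functoriality

/-- A height function: additive, positive, with finitely many elements of each height. -/
structure IsHeight {S : Type*} [Add S] (ht : S → ℤ) : Prop where
  add : ∀ α β, ht (α + β) = ht α + ht β
  pos : ∀ α, 0 < ht α
  finite_level : ∀ n, {α | ht α = n}.Finite

section Finiteness

variable {S : Type w} [Add S] {ht : S → ℤ}

theorem IsHeight.finite_le (h : IsHeight ht) (n : ℤ) : {γ : S × ZMod 2 | ht γ.1 ≤ n}.Finite := by
  have h1 : {α : S | ht α ≤ n}.Finite := by
    refine ((Set.finite_Icc 1 n).biUnion fun m _ => h.finite_level m).subset fun α hα => ?_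
    exact Set.mem_biUnion (x := ht α) ⟨h.pos α, hα⟩ rfl
  exact (h1.prod Set.finite_univ).subset fun γ hγ => ⟨hγ, trivial⟩

theorem IsHeight.finite_antidiagonal (h : IsHeight ht) (γ : S × ZMod 2) :
    Finite {p : (S × ZMod 2) × (S × ZMod 2) // p.1 + p.2 = γ} := by
  refine Set.Finite.to_subtype (((h.finite_le (ht γ.1)).prod (h.finite_le (ht γ.1))).subset ?_)
  rintro p rfl
  have h1 := h.pos p.1.1
  have h2 := h.pos p.2.1
  constructor <;> simp only [Set.mem_ofPred_eq, Prod.fst_add, h.add] <;> omega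

theorem finite_component {K : Type u} [Field K] (h : IsHeight ht) (V : S × ZMod 2 → Type x)
    [∀ γ, AddCommGroup (V γ)] [∀ γ, Module K (V γ)] [∀ γ, Module.Finite K (V γ)]
    (γ : S × ZMod 2) : Module.Finite K (component K V γ) := by
  suffices ∀ (n : ℕ) (γ : S × ZMod 2), ht γ.1 ≤ n → (component K V γ).FG from
    Module.Finite.iff_fg.2 (this (ht γ.1).toNat γ (Int.self_le_toNat _))
  intro n
  induction n with
  | zero => intro γ hγ; have := h.pos γ.1; omega
  | succ n ih =>
    intro γ hγ
    let Q (γ : S × ZMod 2) : Submodule K (FreeLie K V) := LinearMap.range (ι K V γ) ⊔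
      ⨆ p : {p : (S × ZMod 2) × (S × ZMod 2) // p.1 + p.2 = γ},
        Submodule.map₂ (bracket K V) (component K V p.1.1) (component K V p.1.2)
    have hle : component K V γ ≤ Q γ := by
      refine component_le Q (fun γ v => Submodule.mem_sup_left ⟨v, rfl⟩) ?_ γ
      intro α β y z _ hy _ hz
      refine Submodule.mem_sup_right (Submodule.mem_iSup_of_mem ⟨(α, β), rfl⟩ ?_)
      exact Submodule.apply_mem_map₂ _ hy hz
    have hfg : (Q γ).FG := by
      have := h.finite_antidiagonal γ
      refine Submodule.FG.sup (Module.Finite.iff_fg.1 inferInstance) ?_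
      refine Submodule.fg_iSup _ fun p => ?_
      obtain ⟨⟨α, β⟩, rfl⟩ := p
      have h1 := h.pos α.1
      have h2 := h.pos β.1
      simp only [Prod.fst_add, h.add] at hγ
      push_cast at hγ
      exact Submodule.FG.map₂ _ (ih α (by omega)) (ih β (by omega))
    have := Module.Finite.iff_fg.2 hfg
    exact Module.Finite.iff_fg.1 (Submodule.finiteDimensional_of_le hle)

end Finiteness

/-! ### Superderivations -/

section Derivations

set_option linter.unusedSectionVars false

variable {K : Type u} [Field K] {S : Type w} [Add S] {V : S × ZMod 2 → Type x}
  [∀ γ, AddCommGroup (V γ)] [∀ γ, Module K (V γ)]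

theorem lie_mem {a b : ZMod 2} {y z : FreeLie K V} (hy : y ∈ lieParity K V a)
    (hz : z ∈ lieParity K V b) : bracket K V y z ∈ lieParity K V (a + b) :=
  (isSuperBracket_bracket K V).mem hy hz

theorem lie_skew {a b : ZMod 2} {y z : FreeLie K V} (hy : y ∈ lieParity K V a)
    (hz : z ∈ lieParity K V b) :
    bracket K V y z = -(koszul K a b • bracket K V z y) :=
  (isSuperBracket_bracket K V).skew hy hz

theorem lie_jacobi {a b : ZMod 2} {y z : FreeLie K V} (hy : y ∈ lieParity K V a)
    (hz : z ∈ lieParity K V b) (t : FreeLie K V) :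
    bracket K V y (bracket K V z t)
      = bracket K V (bracket K V y z) t + koszul K a b • bracket K V z (bracket K V y t) := by
  have := mem_of_lieParity_le (LinearMap.eqLocus (bracket K V y ∘ₗ bracket K V z)
    (bracket K V (bracket K V y z) + koszul K a b • (bracket K V z ∘ₗ bracket K V y))) ?_ t
  · exact this
  · intro c t ht
    exact (isSuperBracket_bracket K V).jacobi hy hz ht

theorem lie_cube {y : FreeLie K V} (h3 : ringChar K = 3) (hy : y ∈ lieParity K V 1) :
    bracket K V y (bracket K V y y) = 0 :=
  (isSuperBracket_bracket K V).cube h3 hy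

variable (K V) in
/-- The superderivations of parity `e` of the free Lie superalgebra. -/
def superDer (e : ZMod 2) : Submodule K (Module.End K (FreeLie K V)) where
  carrier := {D | (∀ b, ∀ y ∈ lieParity K V b, D y ∈ lieParity K V (e + b)) ∧
    ∀ b, ∀ y ∈ lieParity K V b, ∀ z,
      D (bracket K V y z) = bracket K V (D y) z + koszul K e b • bracket K V y (D z)}
  zero_mem' := ⟨fun _ _ _ => Submodule.zero_mem _, fun _ _ _ _ => by simp⟩
  add_mem' := by
    rintro D E ⟨h1, h2⟩ ⟨h3, h4⟩
    refine ⟨fun b y hy => Submodule.add_mem _ (h1 b y hy) (h3 b y hy), fun b y hy z => ?_⟩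
    simp only [LinearMap.add_apply, map_add, h2 b y hy z, h4 b y hy z, smul_add]
    abel
  smul_mem' := by
    rintro c D ⟨h1, h2⟩
    refine ⟨fun b y hy => Submodule.smul_mem _ c (h1 b y hy), fun b y hy z => ?_⟩
    simp only [LinearMap.smul_apply, map_smul, h2 b y hy z, smul_add]
    rw [smul_comm c (koszul K e b)]

theorem superDer_ext {e : ZMod 2} {D E : Module.End K (FreeLie K V)} (hD : D ∈ superDer K V e)
    (hE : E ∈ superDer K V e) (h : ∀ γ v, D (ι K V γ v) = E (ι K V γ v)) : D = E := by
  refine hom_ext_of_bracket h fun α β y z hy hz h1 h2 => ?_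
  rw [hD.2 _ y (component_le_lieParity α hy), hE.2 _ y (component_le_lieParity α hy), h1, h2]

/-- A linear map of parity `e` from the generators into the free Lie superalgebra extends to a
superderivation: the map `y ↦ y + ε d y`, where `ε` is a constant of parity `e` with `ε ^ 2 = 0`, has
to be a homomorphism of Lie superalgebras. -/
theorem exists_superDer (e : ZMod 2) (d : ∀ γ, V γ →ₗ[K] FreeLie K V)
    (hd : ∀ γ v, d γ v ∈ lieParity K V (e + γ.2)) :
    ∃ D ∈ superDer K V e, ∀ γ v, D (ι K V γ v) = d γ v := by
  let β (b _c : ZMod 2) : FreeLie K V × FreeLie K V →ₗ[K] FreeLie K V × FreeLie K V →ₗ[K]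
      FreeLie K V × FreeLie K V :=
    LinearMap.mk₂ K (fun y z => (bracket K V y.1 z.1,
        bracket K V y.2 z.1 + koszul K e b • bracket K V y.1 z.2))
      (fun y y' z => by ext <;> simp; abel)
      (fun c y z => by ext <;> simp [smul_comm c])
      (fun y z z' => by ext <;> simp; abel)
      (fun c y z => by ext <;> simp [smul_comm c])
  have hβ (b c y z) : β b c y z = (bracket K V y.1 z.1,
        bracket K V y.2 z.1 + koszul K e b • bracket K V y.1 z.2) := rfl
  let Q (b : ZMod 2) : Submodule K (FreeLie K V × FreeLie K V) :=
    (lieParity K V b).prod (lieParity K V (e + b))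
  have h : IsSuperBracket β Q := by
    constructor
    · rintro b c y z ⟨hy1, hy2⟩ ⟨hz1, hz2⟩
      refine ⟨lie_mem hy1 hz1, Submodule.add_mem _ ?_ (Submodule.smul_mem _ _ ?_)⟩
      · rw [← add_assoc]; exact lie_mem hy2 hz1
      · rw [add_left_comm]; exact lie_mem hy1 hz2
    · rintro b c ⟨y, y'⟩ ⟨z, z'⟩ ⟨(hy1 : y ∈ _), (hy2 : y' ∈ _)⟩
        ⟨(hz1 : z ∈ _), (hz2 : z' ∈ _)⟩
      rw [hβ b c, hβ c b]
      refine Prod.ext (lie_skew hy1 hz1) ?_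
      have h1 := lie_skew hy2 hz1
      have h2 := lie_skew hy1 hz2
      simp only [Prod.neg_mk, Prod.smul_mk, smul_add, smul_neg, h1, h2, smul_smul]
      rw [koszul_add_left, koszul_add_right, koszul_comm K b e, ← mul_assoc, koszul_mul_self,
        one_mul, mul_comm (koszul K b c)]
      abel
    · rintro b c d ⟨y, y'⟩ ⟨z, z'⟩ ⟨t, t'⟩ ⟨(hy1 : y ∈ _), (hy2 : y' ∈ _)⟩
        ⟨(hz1 : z ∈ _), (hz2 : z' ∈ _)⟩ ⟨(ht1 : t ∈ _), (ht2 : t' ∈ _)⟩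
      simp only [hβ]
      refine Prod.ext (lie_jacobi hy1 hz1 t) ?_
      have h1 := lie_jacobi hy2 hz1 t
      have h2 := lie_jacobi hy1 hz2 t
      have h3 := lie_jacobi hy1 hz1 t'
      simp only [Prod.smul_mk, Prod.mk_add_mk, map_add, map_smul, LinearMap.add_apply,
        LinearMap.smul_apply, smul_add, h1, h2, h3, smul_smul, koszul_add_left, koszul_add_right]
      rw [koszul_comm K b e]
      have hs := koszul_mul_self K e b
      have e1 : koszul K e b * (koszul K e b * koszul K b c) = koszul K b c := by
        rw [← mul_assoc, hs, one_mul]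
      rw [e1, mul_comm (koszul K b c), mul_comm (koszul K b c)]
      module
    · rintro ⟨y, y'⟩ h3 ⟨(hy1 : y ∈ _), (hy2 : y' ∈ _)⟩
      simp only [hβ]
      refine Prod.ext (lie_cube h3 hy1) ?_
      have h1 := lie_jacobi hy1 hy1 y'
      have h2 := lie_skew hy2 hy1
      have h4 := lie_skew hy2 (lie_mem hy1 hy1)
      rw [koszul_one_one] at h1
      have hs := koszul_mul_self K e 1
      have e1 : koszul K (e + 1) (1 + 1) = 1 := by
        rw [koszul_add_right, koszul_mul_self]
      have e2 : koszul K (e + 1) 1 = - koszul K e 1 := by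
        rw [koszul_add_left, koszul_one_one, mul_neg, mul_one]
      have h5 : bracket K V (bracket K V y y) y' = (2 : K) • bracket K V y (bracket K V y y') := by
        linear_combination (norm := module) (-1 : K) • h1
      rw [e1, h5] at h4
      rw [e2] at h2
      simp only [Prod.snd_zero, map_add, map_smul, h4, h2, map_neg]
      linear_combination (norm := module) (2 : K) • congrArg (· • bracket K V y (bracket K V y y')) hs
  obtain ⟨F, hFg, hFp, hFm⟩ := exists_lift h (fun γ => (ι K V γ).prod (d γ))
    (fun γ v => ⟨ι_mem_lieParity γ v, hd γ v⟩)
  have hF1 : LinearMap.fst K _ _ ∘ₗ F = LinearMap.id := by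
    refine hom_ext_of_bracket (fun γ v => by simp [hFg]) fun α β' y z hy hz h1 h2 => ?_
    have h3 := hFm _ _ y z (component_le_lieParity α hy) (component_le_lieParity β' hz)
    simp only [LinearMap.comp_apply, LinearMap.fst_apply, LinearMap.id_apply] at h1 h2 ⊢
    rw [h3, hβ α.2 β'.2, h1, h2]
  have hF1' (y) : (F y).1 = y := LinearMap.congr_fun hF1 y
  refine ⟨LinearMap.snd K _ _ ∘ₗ F, ⟨fun b y hy => (hFp b y hy).2, fun b y hy z => ?_⟩,
    fun γ v => by simp [hFg]⟩
  have := mem_of_lieParity_le (LinearMap.eqLocus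
    ((LinearMap.snd K _ _ ∘ₗ F) ∘ₗ bracket K V y)
    (bracket K V (F y).2 + koszul K e b • (bracket K V y ∘ₗ (LinearMap.snd K _ _ ∘ₗ F)))) ?_ z
  · exact this
  intro c z hz
  have h3 := congrArg Prod.snd (hFm _ _ y z hy hz)
  rw [hβ b c, hF1', hF1'] at h3
  exact h3

end Derivations

end FreeLieSuper

end

noncomputable section

/-! ### The semidirect product with the superderivations -/

namespace FreeLieSuper

section SemidirectProduct

set_option linter.unusedSectionVars false

variable {K : Type u} [Field K] {S : Type w} [Add S] {V : S × ZMod 2 → Type x}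
  [∀ γ, AddCommGroup (V γ)] [∀ γ, Module K (V γ)]

variable (K V) in
/-- The bracket `[(D, y), (E, z)] = (D E - (-1) ^ (ab) E D, D z - (-1) ^ (ab) E y + [y, z])` of the
semidirect product of the superderivations of `𝔏(V)` with `𝔏(V)`, for elements of parities `a`
and `b`. -/
def semidirectBracket (a b : ZMod 2) :
    Module.End K (FreeLie K V) × FreeLie K V →ₗ[K] Module.End K (FreeLie K V) × FreeLie K V →ₗ[K]
      Module.End K (FreeLie K V) × FreeLie K V :=
  LinearMap.mk₂ K (fun p q => (p.1 * q.1 - koszul K a b • (q.1 * p.1),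
      p.1 q.2 - koszul K a b • q.1 p.2 + bracket K V p.2 q.2))
    (fun p p' q => by ext1 <;> simp [add_mul, mul_add] <;> abel)
    (fun c p q => by ext1 <;> simp [smul_sub, smul_comm c])
    (fun p q q' => by ext1 <;> simp [add_mul, mul_add] <;> abel)
    (fun c p q => by ext1 <;> simp [smul_sub, smul_comm c])

theorem semidirectBracket_apply (a b : ZMod 2)
    (p q : Module.End K (FreeLie K V) × FreeLie K V) :
    semidirectBracket K V a b p q = (p.1 * q.1 - koszul K a b • (q.1 * p.1),
      p.1 q.2 - koszul K a b • q.1 p.2 + bracket K V p.2 q.2) :=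
  rfl

theorem superDer_commutator {a b : ZMod 2} {D E : Module.End K (FreeLie K V)}
    (hD : D ∈ superDer K V a) (hE : E ∈ superDer K V b) :
    D * E - koszul K a b • (E * D) ∈ superDer K V (a + b) := by
  refine ⟨fun c y hy => ?_, fun c y hy z => ?_⟩
  · simp only [LinearMap.sub_apply, LinearMap.smul_apply, Module.End.mul_apply]
    refine Submodule.sub_mem _ ?_ (Submodule.smul_mem _ _ ?_)
    · rw [add_assoc]; exact hD.1 _ _ (hE.1 _ _ hy)
    · rw [add_comm a, add_assoc]; exact hE.1 _ _ (hD.1 _ _ hy)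
  · simp only [LinearMap.sub_apply, LinearMap.smul_apply, Module.End.mul_apply, hD.2 c y hy z,
      hE.2 c y hy z, map_add, map_smul, map_sub, hD.2 _ _ (hE.1 _ _ hy), hE.2 _ _ (hD.1 _ _ hy),
      hD.2 c y hy, hE.2 c y hy, koszul_add_left, koszul_add_right, koszul_comm K b a]
    have hs := koszul_mul_self K a b
    linear_combination (norm := module)
      (-koszul K b c) • congrArg (· • bracket K V (D y) (E z)) hs

theorem isSuperBracket_semidirectBracket :
    IsSuperBracket (semidirectBracket K V)
      (fun a => (superDer K V a).prod (lieParity K V a)) where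
  mem := by
    rintro a b ⟨D, y⟩ ⟨E, z⟩ ⟨hD, (hy : y ∈ _)⟩ ⟨hE, (hz : z ∈ _)⟩
    refine ⟨superDer_commutator hD hE, Submodule.add_mem _
      (Submodule.sub_mem _ (hD.1 _ _ hz) (Submodule.smul_mem _ _ ?_)) (lie_mem hy hz)⟩
    rw [add_comm a b]; exact hE.1 _ _ hy
  skew := by
    rintro a b ⟨D, y⟩ ⟨E, z⟩ ⟨hD, (hy : y ∈ _)⟩ ⟨hE, (hz : z ∈ _)⟩
    rw [semidirectBracket_apply, semidirectBracket_apply]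
    have hs := koszul_mul_self K a b
    have h1 := lie_skew hy hz
    rw [koszul_comm K b a]
    ext1
    · dsimp only
      simp only [Prod.smul_mk, Prod.neg_mk]
      linear_combination (norm := module) (-1 : K) • congrArg (· • (D * E)) hs
    · dsimp only
      simp only [Prod.smul_mk, Prod.neg_mk]
      rw [h1]
      linear_combination (norm := module) (-1 : K) • congrArg (· • D z) hs
  -- in each component both sides agree up to factors that are squares of signs
  jacobi := by
    rintro a b c ⟨D, y⟩ ⟨E, z⟩ ⟨F, t⟩ ⟨hD, (hy : y ∈ _)⟩ ⟨hE, (hz : z ∈ _)⟩ ⟨hF, (ht : t ∈ _)⟩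
    have hs := koszul_mul_self K a b
    simp only [semidirectBracket_apply, Prod.smul_mk, Prod.mk_add_mk, koszul_add_left,
      koszul_add_right, koszul_comm K b a]
    ext1
    · dsimp only
      simp only [mul_sub, sub_mul, mul_smul_comm, smul_mul_assoc, mul_assoc]
      linear_combination (norm := module)
        koszul K b c • congrArg (· • (D * (F * E))) hs
          - (koszul K a c * koszul K b c) • congrArg (· • (F * (D * E))) hs
    · dsimp only
      have hs' := koszul_mul_self K a c
      have h1 := lie_skew hz (hF.1 _ _ hy)
      simp only [LinearMap.sub_apply, LinearMap.smul_apply, Module.End.mul_apply, map_add,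
        map_smul, map_sub, LinearMap.add_apply, hD.2 _ _ hz, hE.2 _ _ hy, hF.2 _ _ hy,
        lie_jacobi hy hz t, h1, koszul_add_right, koszul_comm K c a, koszul_comm K b a]
      linear_combination (norm := module) koszul K b c • congrArg (· • D (F z)) hs
        - (koszul K a c * koszul K b c) • congrArg (· • F (D z)) hs
        - congrArg (· • bracket K V y (E t)) hs
        - (koszul K a c * koszul K b c) • congrArg (· • bracket K V (F y) z) hs
        + koszul K b c • congrArg (· • bracket K V y (F z)) hs'
  cube := by
    rintro ⟨D, y⟩ h3 ⟨hD, (hy : y ∈ _)⟩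
    simp only [semidirectBracket_apply, koszul_add_right, koszul_one_one]
    ext1
    · dsimp only
      simp only [mul_sub, sub_mul, mul_smul_comm, smul_mul_assoc, mul_assoc, Prod.fst_zero]
      module
    · dsimp only
      have h1 := lie_skew (hD.1 _ _ hy) hy
      simp only [LinearMap.sub_apply, LinearMap.smul_apply, Module.End.mul_apply, map_add,
        map_smul, map_sub, hD.2 _ _ hy, lie_cube h3 hy, koszul_one_one, Prod.snd_zero, h1,
        koszul_add_left]
      module

end SemidirectProduct

end FreeLieSuper

end

noncomputable section

/-! ### Elimination -/

namespace FreeLieSuper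

section Elimination

set_option linter.unusedSectionVars false

variable {K : Type u} [Field K] {S : Type w} [AddCommSemigroup S]
  {U V W : S × ZMod 2 → Type x}
  [∀ γ, AddCommGroup (U γ)] [∀ γ, Module K (U γ)]
  [∀ γ, AddCommGroup (V γ)] [∀ γ, Module K (V γ)]
  [∀ γ, AddCommGroup (W γ)] [∀ γ, Module K (W γ)]

variable (K U V) in
/-- The free Lie superalgebra on `U ⊕ V`. -/
abbrev SumLie := FreeLie K (fun γ => U γ × V γ)

/-- `W` is generated by `V` under the action of `U` by left multiplications. -/
def IsGeneratedBy (i : ∀ δ, V δ →ₗ[K] W δ) (m : ∀ α β, U α →ₗ[K] W β →ₗ[K] W (α + β)) : Prop :=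
  ∀ Q : ∀ δ, Submodule K (W δ), (∀ δ v, i δ v ∈ Q δ) →
    (∀ α β u w, w ∈ Q β → m α β u w ∈ Q (α + β)) → ∀ δ w, w ∈ Q δ

variable {i : ∀ δ, V δ →ₗ[K] W δ} {m : ∀ α β, U α →ₗ[K] W β →ₗ[K] W (α + β)}
  {f : ∀ δ, W δ →ₗ[K] SumLie K U V}

theorem IsGeneratedBy.map_mem_component (hW : IsGeneratedBy i m)
    (hfi : ∀ δ v, f δ (i δ v) = ι K _ δ (0, v))
    (hfm : ∀ α β u w, f (α + β) (m α β u w) = bracket K _ (ι K _ α (u, 0)) (f β w))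
    (δ : S × ZMod 2) (w : W δ) : f δ w ∈ component K (fun γ => U γ × V γ) δ := by
  refine hW (fun δ => (component K (fun γ => U γ × V γ) δ).comap (f δ)) (fun δ v => ?_)
    (fun α β u w hw => ?_) δ w
  · rw [Submodule.mem_comap, hfi]; exact ι_mem_component _ _
  · rw [Submodule.mem_comap, hfm]
    exact bracket_mem_component (ι_mem_component _ _) hw

/-- Left multiplication by elements of `U` on `W` extends to superderivations of `𝔏(W)`. -/
theorem exists_superDer_family (m : ∀ α β, U α →ₗ[K] W β →ₗ[K] W (α + β)) (α : S × ZMod 2) :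
    ∃ D : U α →ₗ[K] Module.End K (FreeLie K W), (∀ u, D u ∈ superDer K W α.2) ∧
      ∀ u β w, D u (ι K W β w) = ι K W (α + β) (m α β u w) := by
  have h (u : U α) := exists_superDer (K := K) (V := W) α.2 (fun β => ι K W (α + β) ∘ₗ m α β u)
    (fun β w => ι_mem_lieParity (α + β) _)
  choose D hD hDg using h
  refine ⟨⟨⟨D, fun u u' => ?_⟩, fun c u => ?_⟩, hD, hDg⟩
  · exact superDer_ext (hD _) (Submodule.add_mem _ (hD u) (hD u')) fun γ v => by simp [hDg]
  · exact superDer_ext (hD _) (Submodule.smul_mem _ c (hD u)) fun γ v => by simp [hDg]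

/-- A homomorphism `ψ` from `𝔏(U ⊕ V)` to the semidirect product of the superderivations of
`𝔏(W)` with `𝔏(W)` is a left inverse of the homomorphism from `𝔏(W)` to `𝔏(U ⊕ V)`. -/
theorem elimination_injective (hW : IsGeneratedBy i m)
    (hfi : ∀ δ v, f δ (i δ v) = ι K _ δ (0, v))
    (hfm : ∀ α β u w, f (α + β) (m α β u w) = bracket K _ (ι K _ α (u, 0)) (f β w))
    {Φ₁ : FreeLie K U →ₗ[K] SumLie K U V} (hΦ₁ : ∀ γ u, Φ₁ (ι K U γ u) = ι K _ γ (u, 0))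
    (hΦ₁m : ∀ y z, Φ₁ (bracket K U y z) = bracket K _ (Φ₁ y) (Φ₁ z))
    {Φ₂ : FreeLie K W →ₗ[K] SumLie K U V} (hΦ₂ : ∀ γ w, Φ₂ (ι K W γ w) = f γ w)
    (hΦ₂m : ∀ y z, Φ₂ (bracket K W y z) = bracket K _ (Φ₂ y) (Φ₂ z))
    (hΦ₂c : ∀ γ, ∀ y ∈ component K W γ, Φ₂ y ∈ component K (fun γ => U γ × V γ) γ)
    {y : FreeLie K U} {z : FreeLie K W} (h : Φ₁ y + Φ₂ z = 0) : y = 0 ∧ z = 0 := by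
  -- the projection to `𝔏(U)` that kills `V`
  obtain ⟨R, hRg, hRm, -⟩ := exists_hom (K := K) (V := fun γ => U γ × V γ)
    (fun γ => ι K U γ ∘ₗ LinearMap.fst K _ _) (fun γ v => ι_mem_component _ _)
  have hR1 : R ∘ₗ Φ₁ = LinearMap.id := hom_ext_of_bracket (fun γ u => by simp [hΦ₁, hRg])
    (fun α β y z _ _ hy hz => by
      simp only [LinearMap.comp_apply, LinearMap.id_apply] at hy hz ⊢
      rw [hΦ₁m, hRm, hy, hz])
  have hRf (δ) (w : W δ) : R (f δ w) = 0 := by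
    refine hW (fun δ => LinearMap.ker (R ∘ₗ f δ)) (fun δ v => ?_) (fun α β u w hw => ?_) δ w
    · simp [hfi, hRg]
    · rw [LinearMap.mem_ker, LinearMap.comp_apply] at hw ⊢
      rw [hfm, hRm, hw, map_zero]
  have hR2 : R ∘ₗ Φ₂ = 0 := hom_ext_of_bracket (fun γ w => by simp [hΦ₂, hRf])
    (fun α β y z _ _ hy hz => by
      simp only [LinearMap.comp_apply, LinearMap.zero_apply] at hy hz ⊢
      rw [hΦ₂m, hRm, hy, map_zero, LinearMap.zero_apply])
  have hy : y = 0 := by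
    have h1 := congrArg R h
    rw [map_add, map_zero] at h1
    have h2 := LinearMap.congr_fun hR1 y
    have h3 := LinearMap.congr_fun hR2 z
    simp only [LinearMap.comp_apply, LinearMap.id_apply, LinearMap.zero_apply] at h2 h3
    rwa [h2, h3, add_zero] at h1
  choose D hD hDg using exists_superDer_family (K := K) m
  obtain ⟨ψ, hψg, hψp, hψm⟩ := exists_lift (V := fun γ => U γ × V γ)
    (isSuperBracket_semidirectBracket (K := K) (V := W))
    (fun γ => (D γ).prodMap (ι K W γ ∘ₗ i γ))
    (fun γ v => ⟨hD γ v.1, ι_mem_lieParity _ _⟩)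
  have hψf (δ) (w : W δ) : ψ (f δ w) = (0, ι K W δ w) := by
    refine hW (fun δ => LinearMap.eqLocus (ψ ∘ₗ f δ) (LinearMap.inr K _ _ ∘ₗ ι K W δ))
      (fun δ v => ?_) (fun α β u w hw => ?_) δ w
    · rw [LinearMap.mem_eqLocus, LinearMap.comp_apply, hfi, hψg]
      simp
    · rw [LinearMap.mem_eqLocus, LinearMap.comp_apply] at hw ⊢
      rw [hfm, hψm α.2 β.2 _ _ (ι_mem_lieParity _ _)
        (component_le_lieParity _ (hW.map_mem_component hfi hfm β w)), hw, hψg,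
        semidirectBracket_apply]
      ext1 <;> simp [hDg]
  have hψ2 : ψ ∘ₗ Φ₂ = LinearMap.inr K _ _ := hom_ext_of_bracket (fun γ w => by simp [hΦ₂, hψf])
    (fun α β y z hyc hzc hy hz => by
      simp only [LinearMap.comp_apply] at hy hz ⊢
      rw [hΦ₂m, hψm α.2 β.2 _ _ (component_le_lieParity _ (hΦ₂c _ _ hyc))
        (component_le_lieParity _ (hΦ₂c _ _ hzc)), hy, hz, semidirectBracket_apply]
      ext1 <;> simp)
  refine ⟨hy, ?_⟩
  rw [hy, map_zero, zero_add] at h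
  have h1 := LinearMap.congr_fun hψ2 z
  rw [LinearMap.comp_apply, h, map_zero] at h1
  exact (congrArg Prod.snd h1).symm

/-- The image of `𝔏(W)` in `𝔏(U ⊕ V)` is stable under brackets with the image of `𝔏(U)`, so that the
sum of the two images is a subalgebra. -/
theorem elimination_bracket_mem
    (hfm : ∀ α β u w, f (α + β) (m α β u w) = bracket K _ (ι K _ α (u, 0)) (f β w))
    {Φ₁ : FreeLie K U →ₗ[K] SumLie K U V} (hΦ₁ : ∀ γ u, Φ₁ (ι K U γ u) = ι K _ γ (u, 0))
    (hΦ₁m : ∀ y z, Φ₁ (bracket K U y z) = bracket K _ (Φ₁ y) (Φ₁ z))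
    (hΦ₁c : ∀ γ, ∀ y ∈ component K U γ, Φ₁ y ∈ component K (fun γ => U γ × V γ) γ)
    {Φ₂ : FreeLie K W →ₗ[K] SumLie K U V} (hΦ₂ : ∀ γ w, Φ₂ (ι K W γ w) = f γ w)
    (hΦ₂m : ∀ y z, Φ₂ (bracket K W y z) = bracket K _ (Φ₂ y) (Φ₂ z))
    (hΦ₂c : ∀ γ, ∀ y ∈ component K W γ, Φ₂ y ∈ component K (fun γ => U γ × V γ) γ)
    {α β : S × ZMod 2} {y : FreeLie K U} {z : FreeLie K W} (hy : y ∈ component K U α)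
    (hz : z ∈ component K W β) :
    bracket K _ (Φ₁ y) (Φ₂ z) ∈ (component K W (α + β)).map Φ₂ := by
  -- the image of `𝔏(W)` is stable under brackets with elements of `U`
  have hu (α) (u : U α) (β) (z) (hz : z ∈ component K W β) :
      bracket K _ (ι K _ α (u, 0)) (Φ₂ z) ∈ (component K W (α + β)).map Φ₂ := by
    let P (β : S × ZMod 2) : Submodule K (FreeLie K W) :=
      ((component K W (α + β)).map Φ₂).comap
        (bracket K (fun γ => U γ × V γ) (ι K (fun γ => U γ × V γ) α (u, 0)) ∘ₗ Φ₂)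
    have hP (β z) : z ∈ P β ↔
        bracket K _ (ι K _ α (u, 0)) (Φ₂ z) ∈ (component K W (α + β)).map Φ₂ := Iff.rfl
    refine (hP β z).1 (component_le P (fun γ w => ?_) ?_ β hz)
    · rw [hP, hΦ₂, ← hfm, ← hΦ₂]
      exact Submodule.mem_map_of_mem (ι_mem_component _ _)
    · intro β γ y z hy hyc hz hzc
      rw [hP] at hy hz ⊢
      rw [hΦ₂m, lie_jacobi (ι_mem_lieParity α (u, (0 : V α)))
        (component_le_lieParity _ (hΦ₂c _ _ hyc))]
      obtain ⟨y', hy', hy⟩ := hy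
      obtain ⟨z', hz', hz⟩ := hz
      rw [← hy, ← hz, ← hΦ₂m, ← hΦ₂m, ← map_smul, ← map_add]
      refine Submodule.mem_map_of_mem (Submodule.add_mem _ ?_ (Submodule.smul_mem _ _ ?_))
      · rw [← add_assoc]; exact bracket_mem_component hy' hzc
      · rw [add_left_comm]; exact bracket_mem_component hyc hz'
  let Q (α : S × ZMod 2) : Submodule K (FreeLie K U) :=
    ⨅ β, ⨅ z : component K W β, (((component K W (α + β)).map Φ₂).comap
      ((bracket K _).flip (Φ₂ z.1))).comap Φ₁
  have hQ (α y) : y ∈ Q α ↔ ∀ β, ∀ z ∈ component K W β,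
      bracket K _ (Φ₁ y) (Φ₂ z) ∈ (component K W (α + β)).map Φ₂ := by
    simp [Q, Submodule.mem_iInf]
  have : component K U α ≤ Q α := by
    refine component_le Q (fun γ u => ?_) ?_ α
    · rw [hQ]
      intro β z hz
      rw [hΦ₁]
      exact hu γ u β z hz
    · intro α β y y' hy hyc hy' hyc'
      rw [hQ] at hy hy' ⊢
      intro γ z hz
      have hj := lie_jacobi (component_le_lieParity _ (hΦ₁c _ _ hyc))
        (component_le_lieParity _ (hΦ₁c _ _ hyc')) (Φ₂ z)
      rw [hΦ₁m, ← sub_eq_of_eq_add hj]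
      refine Submodule.sub_mem _ ?_ (Submodule.smul_mem _ _ ?_)
      · obtain ⟨t, ht, h1⟩ := hy' γ z hz
        rw [← h1, add_assoc]
        exact hy _ t ht
      · obtain ⟨t, ht, h1⟩ := hy γ z hz
        rw [← h1, add_assoc, add_left_comm]
        exact hy' _ t ht
  exact (hQ α y).1 (this hy) β z hz

/-- Lazard elimination: if `W` is the free left module generated by `V` over the tensor algebra of `U`,
then `𝔏(U ⊕ V)` is the direct sum of `𝔏(U)` and `𝔏(W)`. Freeness enters through the existence
of the maps `f`, which send `u w` to `[u, f w]`. -/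
theorem elimination {G : Type v} [Group G] (ρU : ∀ γ, Representation K G (U γ))
    (ρV : ∀ γ, Representation K G (V γ)) (ρW : ∀ γ, Representation K G (W γ))
    (hW : IsGeneratedBy i m) (hi : ∀ g δ v, i δ (ρV δ g v) = ρW δ g (i δ v))
    (hm : ∀ g α β u w, m α β (ρU α g u) (ρW β g w) = ρW (α + β) g (m α β u w))
    (hfi : ∀ δ v, f δ (i δ v) = ι K _ δ (0, v))
    (hfm : ∀ α β u w, f (α + β) (m α β u w) = bracket K _ (ι K _ α (u, 0)) (f β w))
    (γ : S × ZMod 2) :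
    Nonempty ((componentRep (fun γ => (ρU γ).prod (ρV γ)) γ).Equiv
      ((componentRep ρU γ).prod (componentRep ρW γ))) := by
  obtain ⟨Φ₁, hΦ₁, hΦ₁m, hΦ₁c⟩ := exists_hom (K := K) (V := U) (V' := fun γ => U γ × V γ)
    (fun γ => ι K _ γ ∘ₗ LinearMap.inl K _ _) (fun γ v => ι_mem_component _ _)
  obtain ⟨Φ₂, hΦ₂, hΦ₂m, hΦ₂c⟩ := exists_hom (K := K) (V := W) (V' := fun γ => U γ × V γ) f
    (hW.map_mem_component hfi hfm)
  have hΦ₁' (γ u) : Φ₁ (ι K U γ u) = ι K (fun γ => U γ × V γ) γ (u, 0) := hΦ₁ γ u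
  have hsum (γ) : component K (fun γ => U γ × V γ) γ ≤
      (component K U γ).map Φ₁ ⊔ (component K W γ).map Φ₂ := by
    refine component_le (fun γ => (component K U γ).map Φ₁ ⊔ (component K W γ).map Φ₂)
      (fun γ v => ?_) ?_ γ
    · have : ι K (fun γ => U γ × V γ) γ v = Φ₁ (ι K U γ v.1) + Φ₂ (ι K W γ (i γ v.2)) := by
        rw [hΦ₁', hΦ₂, hfi, ← map_add]; simp
      rw [this]
      exact Submodule.add_mem_sup (Submodule.mem_map_of_mem (ι_mem_component _ _))
        (Submodule.mem_map_of_mem (ι_mem_component _ _))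
    · intro α β y z hy _ hz _
      obtain ⟨_, ⟨y₁, hy₁, rfl⟩, _, ⟨y₂, hy₂, rfl⟩, rfl⟩ := Submodule.mem_sup.1 hy
      obtain ⟨_, ⟨z₁, hz₁, rfl⟩, _, ⟨z₂, hz₂, rfl⟩, rfl⟩ := Submodule.mem_sup.1 hz
      simp only [map_add, LinearMap.add_apply]
      have hmix {α β y z} := elimination_bracket_mem (α := α) (β := β) (y := y) (z := z)
        hfm hΦ₁' hΦ₁m hΦ₁c hΦ₂ hΦ₂m hΦ₂c
      refine Submodule.add_mem _ (Submodule.add_mem _ ?_ ?_) (Submodule.add_mem _ ?_ ?_)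
      · rw [← hΦ₁m]
        exact Submodule.mem_sup_left (Submodule.mem_map_of_mem (bracket_mem_component hy₁ hz₁))
      · rw [lie_skew (component_le_lieParity _ (hΦ₂c _ _ hy₂))
          (component_le_lieParity _ (hΦ₁c _ _ hz₁)), add_comm α β]
        exact Submodule.mem_sup_right (Submodule.neg_mem _ (Submodule.smul_mem _ _
          (hmix hz₁ hy₂)))
      · exact Submodule.mem_sup_right (hmix hy₁ hz₂)
      · rw [← hΦ₂m]
        exact Submodule.mem_sup_right (Submodule.mem_map_of_mem (bracket_mem_component hy₂ hz₂))
  have hfG (g δ w) : f δ (ρW δ g w) = rep (fun γ => (ρU γ).prod (ρV γ)) g (f δ w) := by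
    refine hW (fun δ => LinearMap.eqLocus (f δ ∘ₗ ρW δ g)
      (rep (fun γ => (ρU γ).prod (ρV γ)) g ∘ₗ f δ)) (fun δ v => ?_) (fun α β u w hw => ?_) δ w
    · rw [LinearMap.mem_eqLocus, LinearMap.comp_apply, LinearMap.comp_apply, ← hi, hfi, hfi,
        rep_ι]
      simp
    · rw [LinearMap.mem_eqLocus, LinearMap.comp_apply, LinearMap.comp_apply] at hw ⊢
      rw [← hm, hfm, hfm, rep_bracket, hw, rep_ι]
      simp
  have hG₁ (g y) : Φ₁ (rep ρU g y) = rep (fun γ => (ρU γ).prod (ρV γ)) g (Φ₁ y) :=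
    hom_rep hΦ₁m g (fun γ v => by rw [hΦ₁', hΦ₁', rep_ι]; simp) y
  have hG₂ (g y) : Φ₂ (rep ρW g y) = rep (fun γ => (ρU γ).prod (ρV γ)) g (Φ₂ y) :=
    hom_rep hΦ₂m g (fun γ v => by rw [hΦ₂, hΦ₂, hfG]) y
  let Ψ : (component K U γ × component K W γ) →ₗ[K] component K (fun γ => U γ × V γ) γ :=
    (Φ₁.restrict (hΦ₁c γ)).coprod (Φ₂.restrict (hΦ₂c γ))
  have hΨ : Function.Bijective Ψ := by
    constructor
    · rw [← LinearMap.ker_eq_bot, LinearMap.ker_eq_bot']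
      rintro ⟨y, z⟩ h
      have h1 := elimination_injective hW hfi hfm hΦ₁' hΦ₁m hΦ₂ hΦ₂m hΦ₂c
        (y := y) (z := z) (congrArg Subtype.val h)
      exact Prod.ext (Subtype.ext h1.1) (Subtype.ext h1.2)
    · rintro ⟨y, hy⟩
      obtain ⟨_, ⟨y₁, hy₁, rfl⟩, _, ⟨y₂, hy₂, rfl⟩, rfl⟩ := Submodule.mem_sup.1 (hsum γ hy)
      exact ⟨(⟨y₁, hy₁⟩, ⟨y₂, hy₂⟩), rfl⟩
  refine ⟨(Representation.Equiv.mk (LinearEquiv.ofBijective Ψ hΨ) fun g => ?_).symm⟩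
  refine LinearMap.ext fun y => Subtype.ext ?_
  change Φ₁ (rep ρU g y.1) + Φ₂ (rep ρW g y.2)
    = rep (fun γ => (ρU γ).prod (ρV γ)) g (Φ₁ y.1 + Φ₂ y.2)
  rw [map_add, hG₁, hG₂]

end Elimination

end FreeLieSuper

end

noncomputable section

/-! ### Modules over the tensor algebra -/

namespace FreeLieSuper

section Tower

variable {K : Type u} [Field K] {G : Type v} [Group G]

/-- The product of a family of `KG`-modules. -/
def piRep {J : Type*} {X : J → Type*} [∀ j, AddCommGroup (X j)] [∀ j, Module K (X j)]
    (ρ : ∀ j, Representation K G (X j)) : Representation K G (∀ j, X j) where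
  toFun g := LinearMap.pi fun j => ρ j g ∘ₗ LinearMap.proj j
  map_one' := by ext; simp
  map_mul' g h := by ext; simp

@[simp] theorem piRep_apply {J : Type*} {X : J → Type*} [∀ j, AddCommGroup (X j)]
    [∀ j, Module K (X j)] (ρ : ∀ j, Representation K G (X j)) (g : G) (f : ∀ j, X j) (j : J) :
    piRep ρ g f j = ρ j g (f j) :=
  rfl

variable {S : Type w} [AddCommSemigroup S] {ht : S → ℤ}
  {U V W : S × ZMod 2 → Type x}
  [∀ γ, AddCommGroup (U γ)] [∀ γ, Module K (U γ)]
  [∀ γ, AddCommGroup (V γ)] [∀ γ, Module K (V γ)]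
  [∀ γ, AddCommGroup (W γ)] [∀ γ, Module K (W γ)]

variable (K U V W) in
/-- The part of degree `δ` of `V ⊕ U ⊗ W`. -/
abbrev TowerStep (δ : S × ZMod 2) : Type _ :=
  V δ × (∀ p : {p : (S × ZMod 2) × (S × ZMod 2) // p.1 + p.2 = δ}, U p.1.1 ⊗[K] W p.1.2)

/-- The action of `G` on the part of degree `δ` of `V ⊕ U ⊗ W`. -/
abbrev towerStepRep (ρU : ∀ γ, Representation K G (U γ)) (ρV : ∀ γ, Representation K G (V γ))
    (ρW : ∀ γ, Representation K G (W γ)) (δ : S × ZMod 2) :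
    Representation K G (TowerStep K U V W δ) :=
  (ρV δ).prod (piRep fun p => (ρU p.1.1).tprod (ρW p.1.2))

/-- The inclusion of `V` in `W ≅ V ⊕ U ⊗ W`. -/
def towerIncl (e : ∀ δ, W δ ≃ₗ[K] TowerStep K U V W δ) (δ : S × ZMod 2) : V δ →ₗ[K] W δ :=
  (e δ).symm.toLinearMap ∘ₗ LinearMap.inl K _ _

open Classical in
/-- Left multiplication by `U` on `W ≅ V ⊕ U ⊗ W`. -/
def towerMul (e : ∀ δ, W δ ≃ₗ[K] TowerStep K U V W δ) (α β : S × ZMod 2) :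
    U α →ₗ[K] W β →ₗ[K] W (α + β) :=
  (TensorProduct.mk K (U α) (W β)).compr₂ ((e (α + β)).symm.toLinearMap ∘ₗ
    LinearMap.inr K _ _ ∘ₗ LinearMap.single K
      (fun p : {p : (S × ZMod 2) × (S × ZMod 2) // p.1 + p.2 = α + β} => U p.1.1 ⊗[K] W p.1.2)
      ⟨(α, β), rfl⟩)

open Classical in
theorem towerMul_apply (e : ∀ δ, W δ ≃ₗ[K] TowerStep K U V W δ) (α β : S × ZMod 2) (u : U α)
    (w : W β) : towerMul e α β u w = (e (α + β)).symm (0, Pi.single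
      (M := fun p : {p : (S × ZMod 2) × (S × ZMod 2) // p.1 + p.2 = α + β} => U p.1.1 ⊗[K] W p.1.2)
      ⟨(α, β), rfl⟩ (u ⊗ₜ w)) :=
  rfl

theorem IsHeight.lt_of_add (h : IsHeight ht) {δ : S × ZMod 2}
    (p : {p : (S × ZMod 2) × (S × ZMod 2) // p.1 + p.2 = δ}) :
    (ht p.1.2.1).toNat < (ht δ.1).toNat := by
  obtain ⟨⟨α, β⟩, rfl⟩ := p
  have h1 := h.pos α.1
  have h2 := h.pos β.1
  simp only [Prod.fst_add, h.add]
  omega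

theorem isGeneratedBy_tower (h : IsHeight ht) (e : ∀ δ, W δ ≃ₗ[K] TowerStep K U V W δ) :
    IsGeneratedBy (towerIncl e) (towerMul e) := by
  classical
  intro Q hi hm
  suffices ∀ (n : ℕ) (δ : S × ZMod 2), (ht δ.1).toNat < n → ∀ w, w ∈ Q δ from
    fun δ w => this _ δ (Nat.lt_succ_self _) w
  intro n
  induction n with
  | zero => intro δ hδ; omega
  | succ n ih =>
    intro δ hδ w
    have := h.finite_antidiagonal δ
    have := Fintype.ofFinite {p : (S × ZMod 2) × (S × ZMod 2) // p.1 + p.2 = δ}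
    have hw : w = towerIncl e δ (e δ w).1 + (e δ).symm (0, (e δ w).2) := by
      rw [towerIncl, LinearMap.comp_apply, LinearEquiv.coe_coe, ← map_add]
      simp
    rw [hw]
    refine (Q δ).add_mem (hi _ _) ?_
    generalize (e δ w).2 = x
    rw [← Finset.univ_sum_single x, ← LinearMap.inr_apply (R := K), map_sum, map_sum]
    refine Submodule.sum_mem _ fun p _ => ?_
    have hlt := h.lt_of_add p
    generalize x p = t
    obtain ⟨⟨α, β⟩, rfl⟩ := p
    induction t using TensorProduct.induction_on with
    | zero => rw [Pi.single_zero, map_zero, map_zero]; exact Submodule.zero_mem _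
    | tmul u w => exact hm α β u w (ih β (hlt.trans_le (Nat.lt_succ_iff.1 hδ)) w)
    | add s t hs ht => rw [Pi.single_add, map_add, map_add]; exact Submodule.add_mem _ hs ht

/-- `W ≅ V ⊕ U ⊗ W` is free over `V` as a left module over the tensor algebra of `U`. -/
theorem exists_tower_map (h : IsHeight ht) (e : ∀ δ, W δ ≃ₗ[K] TowerStep K U V W δ)
    {M : Type*} [AddCommGroup M] [Module K M] (a : ∀ δ, V δ →ₗ[K] M)
    (B : ∀ α, U α →ₗ[K] M →ₗ[K] M) :
    ∃ f : ∀ δ, W δ →ₗ[K] M, (∀ δ v, f δ (towerIncl e δ v) = a δ v) ∧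
      ∀ α β u w, f (α + β) (towerMul e α β u w) = B α u (f β w) := by
  classical
  have := h.finite_antidiagonal
  have (δ : S × ZMod 2) :=
    Fintype.ofFinite {p : (S × ZMod 2) × (S × ZMod 2) // p.1 + p.2 = δ}
  let step (δ : S × ZMod 2)
      (F : ∀ β : S × ZMod 2, (ht β.1).toNat < (ht δ.1).toNat → (W β →ₗ[K] M)) : W δ →ₗ[K] M :=
    ((a δ).coprod (∑ p : {p : (S × ZMod 2) × (S × ZMod 2) // p.1 + p.2 = δ},
      TensorProduct.lift ((B p.1.1).compl₂ (F p.1.2 (h.lt_of_add p))) ∘ₗ LinearMap.proj p)) ∘ₗ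
      (e δ).toLinearMap
  let wf := (measure fun δ : S × ZMod 2 => (ht δ.1).toNat).wf
  let f : ∀ δ, W δ →ₗ[K] M := wf.fix step
  have hf (δ) : f δ = step δ (fun β _ => f β) := wf.fix_eq step δ
  refine ⟨f, fun δ v => ?_, fun α β u w => ?_⟩
  · rw [hf]
    simp [step, towerIncl]
  · rw [hf, towerMul_apply]
    simp only [step, LinearMap.comp_apply, LinearEquiv.coe_coe, LinearEquiv.apply_symm_apply,
      LinearMap.coprod_apply, map_zero, zero_add, LinearMap.sum_apply, LinearMap.proj_apply]
    rw [Finset.sum_eq_single ⟨(α, β), rfl⟩]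
    · rw [Pi.single_eq_same]; simp
    · intro p _ hp
      rw [Pi.single_eq_of_ne hp, map_zero]
    · intro hp; exact absurd (Finset.mem_univ _) hp

/-- Elimination for a module `W` that satisfies `W ≅ V ⊕ U ⊗ W`. -/
theorem elimination_tower (h : IsHeight ht) {ρU : ∀ γ, Representation K G (U γ)}
    {ρV : ∀ γ, Representation K G (V γ)} {ρW : ∀ γ, Representation K G (W γ)}
    (e : ∀ δ, (ρW δ).Equiv (towerStepRep ρU ρV ρW δ)) (γ : S × ZMod 2) :
    Nonempty ((componentRep (fun γ => (ρU γ).prod (ρV γ)) γ).Equiv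
      ((componentRep ρU γ).prod (componentRep ρW γ))) := by
  classical
  let e' (δ) : W δ ≃ₗ[K] TowerStep K U V W δ := (e δ).toLinearEquiv
  obtain ⟨f, hfi, hfm⟩ := exists_tower_map h e' (M := SumLie K U V)
    (fun δ => ι K _ δ ∘ₗ LinearMap.inr K _ _)
    (fun α => bracket K _ ∘ₗ ι K _ α ∘ₗ LinearMap.inl K _ _)
  have he (g δ w) : e' δ (ρW δ g w) = towerStepRep ρU ρV ρW δ g (e' δ w) :=
    LinearMap.congr_fun ((e δ).isIntertwining' g) w
  have hs (g δ x) : (e' δ).symm (towerStepRep ρU ρV ρW δ g x) = ρW δ g ((e' δ).symm x) := by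
    rw [LinearEquiv.symm_apply_eq, he, LinearEquiv.apply_symm_apply]
  refine elimination ρU ρV ρW (isGeneratedBy_tower h e') (fun g δ v => ?_)
    (fun g α β u w => ?_) hfi hfm γ
  · change (e' δ).symm (ρV δ g v, 0) = ρW δ g ((e' δ).symm (v, 0))
    rw [← hs]
    simp
  · rw [towerMul_apply, towerMul_apply, ← hs]
    congr 1
    refine Prod.ext (by simp) ?_
    funext p
    simp only [Representation.prod_apply_apply, piRep_apply]
    by_cases hp : p = ⟨(α, β), rfl⟩
    · subst hp
      rw [Pi.single_eq_same, Pi.single_eq_same]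
      simp
    · rw [Pi.single_eq_of_ne hp, Pi.single_eq_of_ne hp, map_zero]

end Tower

end FreeLieSuper

end

noncomputable section

/-! ### The Green algebra -/

namespace Green

open FreeLieSuper (piRep piRep_apply)

section GreenClass

variable {K : Type u} [Field K] {G : Type v} [Group G]
  {V : Type*} [AddCommGroup V] [Module K V] {W : Type*} [AddCommGroup W] [Module K W]

theorem greenClass_of_finite [h : Module.Finite K V] (ρ : Representation K G V) :
    greenClass ρ = 1 ⊗ₜ[ℤ] Ideal.Quotient.mk (greenIdeal K G)
      (MonoidAlgebra.of ℤ _ (isoClass ρ)) := by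
  rw [greenClass, dif_pos h]

theorem greenClass_congr [Module.Finite K V] {ρ : Representation K G V}
    {σ : Representation K G W} (e : ρ.Equiv σ) : greenClass ρ = greenClass σ := by
  have : Module.Finite K W := Module.Finite.equiv e.toLinearEquiv
  rw [greenClass_of_finite, greenClass_of_finite, isoClass_eq e]

theorem greenClass_prod [Module.Finite K V] [Module.Finite K W] (ρ : Representation K G V)
    (σ : Representation K G W) : greenClass (ρ.prod σ) = greenClass ρ + greenClass σ := by
  rw [greenClass_of_finite, greenClass_of_finite, greenClass_of_finite, ← TensorProduct.tmul_add,
    ← map_add, isoClass_prod]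
  congr 1
  rw [Ideal.Quotient.mk_eq_mk_iff_sub_mem]
  exact Ideal.subset_span ⟨_, _, rfl⟩

theorem greenClass_tprod [Module.Finite K V] [Module.Finite K W] (ρ : Representation K G V)
    (σ : Representation K G W) : greenClass (ρ.tprod σ) = greenClass ρ * greenClass σ := by
  rw [greenClass_of_finite, greenClass_of_finite, greenClass_of_finite,
    Algebra.TensorProduct.tmul_mul_tmul, mul_one, ← map_mul, ← map_mul, isoClass_tprod]
  rfl

theorem greenClass_subsingleton [Subsingleton V] (ρ : Representation K G V) :
    greenClass ρ = 0 := by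
  have e : (ρ.prod ρ).Equiv ρ := Representation.Equiv.mk
    { toFun := fun _ => 0, invFun := fun _ => 0, map_add' := fun _ _ => Subsingleton.elim _ _,
      map_smul' := fun _ _ => Subsingleton.elim _ _, left_inv := fun _ => Subsingleton.elim _ _,
      right_inv := fun _ => Subsingleton.elim _ _ }
    (fun g => LinearMap.ext fun _ => Subsingleton.elim _ _)
  have h := greenClass_congr e
  rw [greenClass_prod] at h
  exact add_eq_left.1 h

theorem greenClass_piRep {J : Type*} [Fintype J] (X : J → Type w) [∀ j, AddCommGroup (X j)]
    [∀ j, Module K (X j)] [∀ j, Module.Finite K (X j)] (ρ : ∀ j, Representation K G (X j)) :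
    greenClass (piRep ρ) = ∑ j, greenClass (ρ j) := by
  revert X
  refine Fintype.induction_empty_option (P := fun J _ => ∀ (X : J → Type w)
    [∀ j, AddCommGroup (X j)] [∀ j, Module K (X j)] [∀ j, Module.Finite K (X j)]
    (ρ : ∀ j, Representation K G (X j)), greenClass (piRep ρ) = ∑ j, greenClass (ρ j))
    ?_ ?_ ?_ J
  · intro α β _ e ih X _ _ _ ρ
    let _ := Fintype.ofEquiv β e.symm
    have e' : (piRep ρ).Equiv (piRep fun a => ρ (e a)) := Representation.Equiv.mk
      (LinearEquiv.piCongrLeft K X e).symm (fun g => LinearMap.ext fun f => rfl)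
    rw [greenClass_congr e', ih]
    exact e.sum_comp fun b => greenClass (ρ b)
  · intro X _ _ _ ρ
    rw [greenClass_subsingleton]
    rfl
  · intro α _ ih X _ _ _ ρ
    have e : (piRep ρ).Equiv ((ρ none).prod (piRep fun a => ρ (some a))) :=
      Representation.Equiv.mk (LinearEquiv.piOptionEquivProd K)
        (fun g => LinearMap.ext fun f => rfl)
    rw [greenClass_congr e, greenClass_prod, ih, Fintype.sum_option]

/-- Tensor products distribute over direct sums. -/
theorem IsoClass.mul_directSum (a b c : IsoClass K G) :
    a * b.directSum c = (a * b).directSum (a * c) := by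
  obtain ⟨A, rfl⟩ := a.exists_rep
  obtain ⟨B, rfl⟩ := b.exists_rep
  obtain ⟨C, rfl⟩ := c.exists_rep
  change IsoClass.tensor _ _ = IsoClass.directSum (IsoClass.tensor _ _) (IsoClass.tensor _ _)
  rw [← isoClass_prod, ← isoClass_tprod, ← isoClass_tprod, ← isoClass_tprod, ← isoClass_prod]
  refine isoClass_eq (Representation.Equiv.mk (TensorProduct.prodRight K K _ _ _) fun g => ?_)
  refine TensorProduct.ext' fun x y => ?_
  simp

/-- A `ℂ`-subspace of the Green algebra that contains the classes of all modules is everything. -/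
theorem mem_of_greenClass_mem (N : Submodule ℂ (GreenAlgebra K G))
    (h : ∀ A : MatRep K G, greenClass A.2 ∈ N) (y : GreenAlgebra K G) : y ∈ N := by
  induction y using TensorProduct.induction_on with
  | zero => exact N.zero_mem
  | add y z hy hz => exact N.add_mem hy hz
  | tmul c r =>
    have hc : c ⊗ₜ[ℤ] r = c • ((1 : ℂ) ⊗ₜ[ℤ] r : GreenAlgebra K G) := by
      rw [TensorProduct.smul_tmul', smul_eq_mul, mul_one]
    rw [hc]
    refine N.smul_mem c ?_
    clear hc
    obtain ⟨r, rfl⟩ := Ideal.Quotient.mk_surjective r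
    induction r using MonoidAlgebra.induction_on with
    | of a =>
      obtain ⟨A, rfl⟩ := a.exists_rep
      rw [← greenClass_of_finite]
      exact h A
    | add y z hy hz => rw [map_add, TensorProduct.tmul_add]; exact N.add_mem hy hz
    | smul n y hy =>
      have : (1 : ℂ) ⊗ₜ[ℤ] (Ideal.Quotient.mk (greenIdeal K G)) (n • y)
          = n • ((1 : ℂ) ⊗ₜ[ℤ] (Ideal.Quotient.mk (greenIdeal K G)) y : GreenAlgebra K G) := by
        rw [map_zsmul, TensorProduct.tmul_smul]
      rw [this]
      exact zsmul_mem hy n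

/-- The direct sum with a zero module on the right. -/
def prodSubsingletonEquiv {V W : Type*} [AddCommGroup V] [Module K V] [AddCommGroup W]
    [Module K W] [Subsingleton W] (ρ : Representation K G V) (σ : Representation K G W) :
    (ρ.prod σ).Equiv ρ :=
  Representation.Equiv.mk
    (LinearEquiv.ofLinearMap (LinearMap.fst K _ _) (LinearMap.inl K _ _) (by ext; simp)
      (LinearMap.ext fun y => Prod.ext (by simp) (Subsingleton.elim _ _)))
    (fun g => LinearMap.ext fun y => by simp)

/-- An additive function of modules extends to a linear map on the Green algebra. -/
theorem exists_linearMap_of_additive {Y : Type*} [AddCommGroup Y] [Module ℂ Y]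
    (t : MatRep K G → Y)
    (ht : ∀ A B C : MatRep K G, C.2.Equiv (A.2.prod B.2) → t C = t A + t B) :
    ∃ φ : GreenAlgebra K G →ₗ[ℂ] Y, ∀ A : MatRep K G, φ (greenClass A.2) = t A := by
  have hcongr (A B : MatRep K G) (e : A.2.Equiv B.2) : t A = t B := by
    let Z : MatRep K G := ⟨0, 1⟩
    have hZ : Subsingleton (Fin Z.1 → K) := inferInstanceAs (Subsingleton (Fin 0 → K))
    have f : (B.2.prod Z.2).Equiv B.2 := prodSubsingletonEquiv _ _
    exact (ht B Z A (e.trans f.symm)).trans (ht B Z B f.symm).symm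
  let t' : IsoClass K G → Y := Quotient.lift t fun A B ⟨e⟩ => hcongr A B e
  have ht' (A : MatRep K G) : t' (isoClass A.2) = t A := by rw [isoClass_mk]; rfl
  have hadd (a b : IsoClass K G) : t' (a.directSum b) = t' a + t' b := by
    obtain ⟨A, rfl⟩ := Quotient.exists_rep a
    obtain ⟨B, rfl⟩ := Quotient.exists_rep b
    exact ht A B _ (transportEquiv _ _).symm
  let φ₀ : MonoidAlgebra ℤ (IsoClass K G) →ₗ[ℤ] Y :=
    Finsupp.linearCombination ℤ t' ∘ₗ (MonoidAlgebra.coeffLinearEquiv ℤ).toLinearMap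
  have hφ₀ (a : IsoClass K G) : φ₀ (MonoidAlgebra.of ℤ _ a) = t' a := by
    change Finsupp.linearCombination ℤ t' (Finsupp.single a 1) = t' a
    rw [Finsupp.linearCombination_single, one_smul]
  -- the kernel need not be an ideal, but it contains the largest ideal below it
  let N : Ideal (MonoidAlgebra ℤ (IsoClass K G)) :=
    { carrier := {x | ∀ y, φ₀ (y * x) = 0}
      add_mem' := fun {x x'} hx hx' y => by rw [mul_add, map_add, hx, hx', add_zero]
      zero_mem' := fun y => by rw [mul_zero, map_zero]
      smul_mem' := fun c x hx y => by rw [smul_eq_mul, ← mul_assoc]; exact hx _ }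
  have hN : greenIdeal K G ≤ N := by
    refine Ideal.span_le.2 ?_
    rintro _ ⟨a, b, rfl⟩ y
    induction y using MonoidAlgebra.induction_on with
    | of c =>
      rw [mul_sub, mul_add, ← map_mul, ← map_mul, ← map_mul, map_sub, map_add, hφ₀, hφ₀, hφ₀,
        IsoClass.mul_directSum, hadd, sub_self]
    | add y z hy hz => rw [add_mul, map_add, hy, hz, add_zero]
    | smul n y hy => rw [smul_mul_assoc, map_zsmul, hy, smul_zero]
  let φ₁ : GreenRing K G →ₗ[ℤ] Y :=
    (QuotientAddGroup.lift (greenIdeal K G).toAddSubgroup φ₀.toAddMonoidHom (fun y hy => by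
      have := hN hy 1
      rwa [one_mul] at this)).toIntLinearMap
  refine ⟨φ₁.liftBaseChange ℂ, fun A => ?_⟩
  rw [greenClass_of_finite, LinearMap.liftBaseChange_tmul, one_smul, ← ht', ← hφ₀]
  rfl

end GreenClass

section Families

variable {K : Type u} [Field K] {G : Type v} [Group G]

/-- A finite dimensional `KG`-module in coordinates. -/
def matRep {V : Type*} [AddCommGroup V] [Module K V] [Module.Finite K V]
    (ρ : Representation K G V) : MatRep K G :=
  ⟨Module.finrank K V, transport ρ (Module.finBasis K V).equivFun⟩

/-- A module is isomorphic to its description in coordinates. -/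
def matRepEquiv {V : Type*} [AddCommGroup V] [Module K V] [Module.Finite K V]
    (ρ : Representation K G V) : ρ.Equiv (matRep ρ).2 :=
  transportEquiv _ _

/-- For graded modules `U` and `V` there is a graded module `W ≅ V ⊕ U ⊗ W`, constructed by
recursion on the height. It is the tensor product of the tensor algebra of `U` with `V`. -/
theorem exists_tower {S : Type w} [AddCommSemigroup S] {ht : S → ℤ}
    (h : FreeLieSuper.IsHeight ht) (U V : S × ZMod 2 → MatRep K G) :
    ∃ W : S × ZMod 2 → MatRep K G, ∀ δ, Nonempty ((W δ).2.Equiv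
      (FreeLieSuper.towerStepRep (fun γ => (U γ).2) (fun γ => (V γ).2) (fun γ => (W γ).2) δ)) := by
  have := h.finite_antidiagonal
  let step (δ : S × ZMod 2)
      (F : ∀ β : S × ZMod 2, (ht β.1).toNat < (ht δ.1).toNat → MatRep K G) : MatRep K G :=
    matRep ((V δ).2.prod (piRep fun p : {p : (S × ZMod 2) × (S × ZMod 2) // p.1 + p.2 = δ} =>
      (U p.1.1).2.tprod (F p.1.2 (h.lt_of_add p)).2))
  let wf := (measure fun δ : S × ZMod 2 => (ht δ.1).toNat).wf
  refine ⟨wf.fix step, fun δ => ?_⟩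
  have hW : wf.fix step δ = step δ (fun β _ => wf.fix step β) := wf.fix_eq step δ
  rw [hW]
  exact ⟨(matRepEquiv _).symm⟩

end Families

end Green

end

noncomputable section

/-! ### The algebra of graded series and its logarithm -/

namespace GradedSeries

open FreeLieSuper (IsHeight)

/-- Every degree is a sum of two degrees in finitely many ways. -/
class FiniteDecomposition (S : Type*) [Add S] : Prop where
  finite : ∀ γ : S × ZMod 2, Finite {p : (S × ZMod 2) × (S × ZMod 2) // p.1 + p.2 = γ}

section Ring

set_option linter.unusedSectionVars false

variable {S : Type*} [AddCommSemigroup S] [FiniteDecomposition S]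
  {R : Type*} [CommRing R] [Algebra ℂ R]

/-- The finite set of pairs of degrees with sum `γ`. -/
def antidiagonal (γ : S × ZMod 2) : Finset ((S × ZMod 2) × (S × ZMod 2)) :=
  haveI := FiniteDecomposition.finite γ
  haveI := Fintype.ofFinite {p : (S × ZMod 2) × (S × ZMod 2) // p.1 + p.2 = γ}
  (Finset.univ : Finset {p : (S × ZMod 2) × (S × ZMod 2) // p.1 + p.2 = γ}).map
    (Function.Embedding.subtype _)

theorem mem_antidiagonal {γ : S × ZMod 2} {p : (S × ZMod 2) × (S × ZMod 2)} :
    p ∈ antidiagonal γ ↔ p.1 + p.2 = γ := by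
  simp [antidiagonal]

theorem mul_apply (f g : GradedSeries S R) (γ : S × ZMod 2) :
    (f * g) γ = ∑ p ∈ antidiagonal γ, f p.1 * g p.2 := by
  have := FiniteDecomposition.finite γ
  have := Fintype.ofFinite {p : (S × ZMod 2) × (S × ZMod 2) // p.1 + p.2 = γ}
  change ∑ᶠ p : {p : (S × ZMod 2) × (S × ZMod 2) // p.1 + p.2 = γ}, f p.1.1 * g p.1.2 = _
  rw [antidiagonal, Finset.sum_map, finsum_eq_sum_of_fintype]
  refine Finset.sum_congr (by ext; simp) fun p _ => rfl

@[simp] theorem add_apply (f g : GradedSeries S R) (γ : S × ZMod 2) : (f + g) γ = f γ + g γ := rfl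
@[simp] theorem sub_apply (f g : GradedSeries S R) (γ : S × ZMod 2) : (f - g) γ = f γ - g γ := rfl
@[simp] theorem zero_apply (γ : S × ZMod 2) : (0 : GradedSeries S R) γ = 0 := rfl
@[simp] theorem smul_apply (c : ℂ) (f : GradedSeries S R) (γ : S × ZMod 2) :
    (c • f) γ = c • f γ := rfl

theorem sum_apply {J : Type*} (s : Finset J) (f : J → GradedSeries S R) (γ : S × ZMod 2) :
    (∑ j ∈ s, f j) γ = ∑ j ∈ s, f j γ :=
  Finset.sum_apply γ s f

instance : NonUnitalCommRing (GradedSeries S R) :=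
  { GradedSeries.instAddCommGroup with
    mul := fun f g => f * g
    left_distrib := fun f g k => funext fun γ => by
      change (f * (g + k)) γ = (f * g) γ + (f * k) γ
      simp only [mul_apply, add_apply, mul_add, Finset.sum_add_distrib]
    right_distrib := fun f g k => funext fun γ => by
      change ((f + g) * k) γ = (f * k) γ + (g * k) γ
      simp only [mul_apply, add_apply, add_mul, Finset.sum_add_distrib]
    zero_mul := fun f => funext fun γ => by
      change ((0 : GradedSeries S R) * f) γ = 0
      simp [mul_apply]
    mul_zero := fun f => funext fun γ => by
      change (f * (0 : GradedSeries S R)) γ = 0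
      simp [mul_apply]
    mul_assoc := fun f g k => funext fun γ => by
      change ((f * g) * k) γ = (f * (g * k)) γ
      simp only [mul_apply, Finset.sum_mul, Finset.mul_sum]
      rw [Finset.sum_sigma', Finset.sum_sigma']
      refine Finset.sum_nbij' (fun p => ⟨(p.2.1, p.2.2 + p.1.2), (p.2.2, p.1.2)⟩)
        (fun p => ⟨(p.1.1 + p.2.1, p.2.2), (p.1.1, p.2.1)⟩) ?_ ?_ ?_ ?_ ?_
      · rintro ⟨⟨a, b⟩, ⟨c, d⟩⟩ hp
        simp only [Finset.mem_sigma, mem_antidiagonal] at hp ⊢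
        obtain ⟨rfl, rfl⟩ := hp
        exact ⟨(add_assoc _ _ _).symm, trivial⟩
      · rintro ⟨⟨a, b⟩, ⟨c, d⟩⟩ hp
        simp only [Finset.mem_sigma, mem_antidiagonal] at hp ⊢
        obtain ⟨rfl, rfl⟩ := hp
        exact ⟨add_assoc _ _ _, trivial⟩
      · rintro ⟨⟨a, b⟩, ⟨c, d⟩⟩ hp
        simp only [Finset.mem_sigma, mem_antidiagonal] at hp
        obtain ⟨rfl, rfl⟩ := hp
        rfl
      · rintro ⟨⟨a, b⟩, ⟨c, d⟩⟩ hp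
        simp only [Finset.mem_sigma, mem_antidiagonal] at hp
        obtain ⟨rfl, rfl⟩ := hp
        rfl
      · intro p _
        exact mul_assoc _ _ _
    mul_comm := fun f g => funext fun γ => by
      change (f * g) γ = (g * f) γ
      rw [mul_apply, mul_apply]
      refine Finset.sum_nbij' Prod.swap Prod.swap ?_ ?_ (fun _ _ => rfl) (fun _ _ => rfl)
        (fun _ _ => mul_comm _ _) <;>
      · intro p hp
        rw [mem_antidiagonal] at hp ⊢
        rw [← hp]
        exact add_comm _ _ }

instance : IsScalarTower ℂ (GradedSeries S R) (GradedSeries S R) :=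
  ⟨fun c f g => funext fun γ => by
    simp only [smul_eq_mul, smul_apply, mul_apply, Finset.smul_sum, smul_mul_assoc]⟩

instance : SMulCommClass ℂ (GradedSeries S R) (GradedSeries S R) :=
  ⟨fun c f g => funext fun γ => by
    simp only [smul_eq_mul, smul_apply, mul_apply, Finset.smul_sum, mul_smul_comm]⟩

/-- The algebra of graded series with a unit adjoined. -/
abbrev Unital (S R : Type*) : Type _ := Unitization ℂ (GradedSeries S R)

theorem inr_smul' (c : ℂ) (f : GradedSeries S R) :
    ((c • f : GradedSeries S R) : Unital S R) = algebraMap ℂ (Unital S R) c * f := by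
  rw [Unitization.inr_smul, Algebra.smul_def]

end Ring

section Filtration

set_option linter.unusedSectionVars false

variable {S : Type*} [AddCommSemigroup S] {ht : S → ℤ} {R : Type*} [CommRing R] [Algebra ℂ R]

/-- The series all of whose terms have height at least `n`, as a subspace. -/
def filt (ht : S → ℤ) (R : Type*) [CommRing R] [Algebra ℂ R] (n : ℕ) :
    Submodule ℂ (GradedSeries S R) where
  carrier := filtration ht n
  add_mem' {f g} hf hg γ hγ := by
    change f γ + g γ = 0
    rw [hf γ hγ, hg γ hγ, add_zero]
  zero_mem' _ _ := rfl
  smul_mem' c f hf γ hγ := by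
    change c • f γ = 0
    rw [hf γ hγ, smul_zero]

theorem filt_anti {m n : ℕ} (hmn : m ≤ n) {f : GradedSeries S R} (hf : f ∈ filt ht R n) :
    f ∈ filt ht R m :=
  fun γ hγ => hf γ (hγ.trans_le (by exact_mod_cast hmn))

theorem mem_filt_one (h : IsHeight ht) (f : GradedSeries S R) : f ∈ filt ht R 1 := by
  intro γ hγ
  have := h.pos γ.1
  push_cast at hγ
  omega

theorem mul_mem_filt [FiniteDecomposition S] (h : IsHeight ht) {m n : ℕ} {f g : GradedSeries S R}
    (hf : f ∈ filt ht R m) (hg : g ∈ filt ht R n) : f * g ∈ filt ht R (m + n) := by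
  intro γ hγ
  rw [mul_apply]
  refine Finset.sum_eq_zero fun p hp => ?_
  rw [mem_antidiagonal] at hp
  subst hp
  rw [Prod.fst_add, h.add] at hγ
  push_cast at hγ
  by_cases h1 : ht p.1.1 < m
  · rw [hf _ h1, zero_mul]
  · rw [hg p.2 (by omega), mul_zero]

theorem eq_zero_of_mem_filt {f : GradedSeries S R} (h : ∀ n, f ∈ filt ht R n) : f = 0 :=
  funext fun γ => h ((ht γ.1).toNat + 1) γ (by push_cast; have := Int.self_le_toNat (ht γ.1); omega)

theorem powSucc_mem_filt [FiniteDecomposition S] (h : IsHeight ht) {n : ℕ} {f : GradedSeries S R}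
    (hf : f ∈ filt ht R n) (k : ℕ) : powSucc f k ∈ filt ht R (n + k) := by
  induction k with
  | zero => exact hf
  | succ k ih =>
    have := mul_mem_filt h ih (mem_filt_one h f)
    exact this

/-- The coefficient `c (c - 1) ⋯ (c - k) / (k + 1)!` of `f ^ (k + 1)` in `(1 + f) ^ c - 1`. -/
def binomCoeff (c : ℂ) (k : ℕ) : ℂ :=
  (∏ i ∈ Finset.range (k + 1), (c - (i : ℂ))) / (Nat.factorial (k + 1) : ℂ)

theorem binomCoeff_zero (c : ℂ) : binomCoeff c 0 = c := by
  simp [binomCoeff]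

theorem binomCoeff_succ (c : ℂ) (k : ℕ) :
    ((k : ℂ) + 2) * binomCoeff c (k + 1) = (c - (k + 1)) * binomCoeff c k := by
  have h1 : (Nat.factorial (k + 1) : ℂ) ≠ 0 := by exact_mod_cast Nat.factorial_ne_zero _
  have h2 : (k : ℂ) + 2 ≠ 0 := by
    exact_mod_cast (Nat.succ_ne_zero (k + 1))
  rw [binomCoeff, binomCoeff, Finset.prod_range_succ, Nat.factorial_succ (k + 1)]
  push_cast
  rw [show (k : ℂ) + 1 + 1 = k + 2 by ring]
  field_simp

/-- The partial sums of `(1 + f) ^ c - 1`. -/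
theorem onePlusPowSubOne_sub_mem [FiniteDecomposition S] (h : IsHeight ht) {n : ℕ}
    {f : GradedSeries S R} (hf : f ∈ filt ht R n) (c : ℂ) (N : ℕ) :
    onePlusPowSubOne f c - ∑ k ∈ Finset.range N, binomCoeff c k • powSucc f k
      ∈ filt ht R (n + N) := by
  intro γ hγ
  rw [sub_apply, sum_apply, sub_eq_zero]
  refine finsum_eq_sum_of_support_subset _ fun k hk => ?_
  rw [Finset.coe_range, Set.mem_Iio]
  by_contra hN
  refine hk ?_
  change _ • powSucc f k γ = 0
  rw [powSucc_mem_filt h hf k γ (by push_cast at hγ ⊢; omega), smul_zero]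

end Filtration

section Logarithm

set_option linter.unusedSectionVars false

variable {S : Type*} [AddCommSemigroup S] {ht : S → ℤ} {R : Type*} [CommRing R] [Algebra ℂ R]

/-- The Euler derivation, which multiplies the term of degree `γ` by its height. -/
def euler (ht : S → ℤ) (R : Type*) [CommRing R] [Algebra ℂ R] :
    GradedSeries S R →ₗ[ℂ] GradedSeries S R where
  toFun f γ := (ht γ.1 : ℂ) • f γ
  map_add' _ _ := funext fun _ => smul_add _ _ _
  map_smul' _ _ := funext fun _ => smul_comm _ _ _

theorem euler_apply (f : GradedSeries S R) (γ : S × ZMod 2) :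
    euler ht R f γ = (ht γ.1 : ℂ) • f γ :=
  rfl

/-- The inverse of the Euler derivation. -/
def eulerInv (ht : S → ℤ) (R : Type*) [CommRing R] [Algebra ℂ R] :
    GradedSeries S R →ₗ[ℂ] GradedSeries S R where
  toFun f γ := (ht γ.1 : ℂ)⁻¹ • f γ
  map_add' _ _ := funext fun _ => smul_add _ _ _
  map_smul' _ _ := funext fun _ => smul_comm _ _ _

theorem euler_eulerInv (h : IsHeight ht) (f : GradedSeries S R) :
    euler ht R (eulerInv ht R f) = f := by
  funext γ
  have : (ht γ.1 : ℂ) ≠ 0 := by exact_mod_cast (h.pos γ.1).ne'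
  change (ht γ.1 : ℂ) • (ht γ.1 : ℂ)⁻¹ • (f γ : R) = f γ
  rw [smul_smul, mul_inv_cancel₀ this, one_smul]

theorem eulerInv_euler (h : IsHeight ht) (f : GradedSeries S R) :
    eulerInv ht R (euler ht R f) = f := by
  funext γ
  have : (ht γ.1 : ℂ) ≠ 0 := by exact_mod_cast (h.pos γ.1).ne'
  change (ht γ.1 : ℂ)⁻¹ • (ht γ.1 : ℂ) • (f γ : R) = f γ
  rw [smul_smul, inv_mul_cancel₀ this, one_smul]

theorem euler_mem_filt {n : ℕ} {f : GradedSeries S R} (hf : f ∈ filt ht R n) :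
    euler ht R f ∈ filt ht R n := fun γ hγ => by
  rw [euler_apply, hf γ hγ, smul_zero]

theorem eulerInv_mem_filt {n : ℕ} {f : GradedSeries S R} (hf : f ∈ filt ht R n) :
    eulerInv ht R f ∈ filt ht R n := fun γ hγ => by
  change (_ : ℂ) • f γ = 0
  rw [hf γ hγ, smul_zero]

variable [FiniteDecomposition S]

theorem euler_mul (h : IsHeight ht) (f g : GradedSeries S R) :
    euler ht R (f * g) = euler ht R f * g + f * euler ht R g := by
  funext γ
  simp only [euler_apply, add_apply, mul_apply, Finset.smul_sum, ← Finset.sum_add_distrib]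
  refine Finset.sum_congr rfl fun p hp => ?_
  rw [mem_antidiagonal] at hp
  subst hp
  rw [Prod.fst_add, h.add, smul_mul_assoc, mul_smul_comm, ← add_smul]
  push_cast
  rfl

theorem inr_powSucc (f : GradedSeries S R) (k : ℕ) :
    ((powSucc f k : GradedSeries S R) : Unital S R) = (f : Unital S R) ^ (k + 1) := by
  induction k with
  | zero => rw [zero_add, pow_one]; rfl
  | succ k ih =>
    rw [pow_succ, ← ih, ← Unitization.inr_mul]
    rfl

theorem inr_euler_powSucc (h : IsHeight ht) (f : GradedSeries S R) (k : ℕ) :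
    ((euler ht R (powSucc f k) : GradedSeries S R) : Unital S R)
      = algebraMap ℂ (Unital S R) (k + 1) * (f : Unital S R) ^ k * (euler ht R f : Unital S R) := by
  induction k with
  | zero => simp [powSucc]
  | succ k ih =>
    have : powSucc f (k + 1) = powSucc f k * f := rfl
    rw [this, euler_mul h, Unitization.inr_add, Unitization.inr_mul, Unitization.inr_mul, ih,
      inr_powSucc]
    simp only [Nat.cast_succ, map_add, map_one, map_natCast]
    ring

theorem exists_mem_filt_pow_mul (h : IsHeight ht) (f g : GradedSeries S R) (k : ℕ) :
    ∃ t ∈ filt ht R k, (f : Unital S R) ^ k * (g : Unital S R) = (t : Unital S R) := by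
  induction k with
  | zero => exact ⟨g, filt_anti (Nat.zero_le 1) (mem_filt_one h g), by rw [pow_zero, one_mul]⟩
  | succ k ih =>
    obtain ⟨t, ht', e⟩ := ih
    refine ⟨t * f, mul_mem_filt h ht' (mem_filt_one h f), ?_⟩
    rw [Unitization.inr_mul, ← e]
    ring

/-- The differential equation `(1 + f) θ((1 + f) ^ c) = c (1 + f) ^ c θ(f)` of the binomial
series, for the Euler derivation `θ`. -/
theorem euler_onePlusPowSubOne (h : IsHeight ht) (f : GradedSeries S R) (c : ℂ) :
    (1 + (f : Unital S R)) * (euler ht R (onePlusPowSubOne f c) : Unital S R)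
      = algebraMap ℂ (Unital S R) c * (1 + (onePlusPowSubOne f c : Unital S R))
        * (euler ht R f : Unital S R) := by
  -- the error of a series `b` as a solution of the equation
  let E (b : GradedSeries S R) : GradedSeries S R :=
    euler ht R b + f * euler ht R b - c • (euler ht R f + b * euler ht R f)
  have hE (b : GradedSeries S R) : ((E b : GradedSeries S R) : Unital S R)
      = (1 + (f : Unital S R)) * (euler ht R b : Unital S R)
        - algebraMap ℂ (Unital S R) c * (1 + (b : Unital S R)) * (euler ht R f : Unital S R) := by
    simp only [E, Unitization.inr_sub, Unitization.inr_add, Unitization.inr_mul, inr_smul']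
    ring
  let b (N : ℕ) : GradedSeries S R := ∑ k ∈ Finset.range N, binomCoeff c k • powSucc f k
  have hb (N : ℕ) : ((E (b N) : GradedSeries S R) : Unital S R)
      = -(algebraMap ℂ (Unital S R) ((N + 1) * binomCoeff c N) * ((f : Unital S R) ^ N
        * (euler ht R f : Unital S R))) := by
    induction N with
    | zero =>
      rw [hE]
      simp [b, binomCoeff_zero]
    | succ N ih =>
      have hb' : b (N + 1) = b N + binomCoeff c N • powSucc f N := Finset.sum_range_succ _ _
      have hc := congrArg (algebraMap ℂ (Unital S R)) (binomCoeff_succ c N)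
      rw [hE] at ih
      rw [hE, hb', map_add, map_smul, Unitization.inr_add, Unitization.inr_add, inr_smul',
        inr_smul', inr_euler_powSucc h, inr_powSucc]
      simp only [Nat.cast_succ, map_add, map_mul, map_sub, map_one, map_ofNat, map_natCast]
        at ih hc ⊢
      linear_combination ih + (f : Unital S R) ^ (N + 1) * (euler ht R f : Unital S R) * hc
  have hlim : E (onePlusPowSubOne f c) = 0 := by
    refine eq_zero_of_mem_filt (ht := ht) fun N => ?_
    have h1 : E (b N) ∈ filt ht R N := by
      obtain ⟨t, ht', e⟩ := exists_mem_filt_pow_mul h f (euler ht R f) N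
      have : E (b N) = -(((N + 1) * binomCoeff c N) • t) := by
        refine Unitization.inr_injective (R := ℂ) ?_
        rw [hb, e, Unitization.inr_neg, inr_smul']
      rw [this]
      exact neg_mem (Submodule.smul_mem _ _ ht')
    have h2 : onePlusPowSubOne f c - b N ∈ filt ht R N :=
      filt_anti (Nat.le_add_left _ _) (onePlusPowSubOne_sub_mem h (mem_filt_one h f) c N)
    have h3 : E (onePlusPowSubOne f c) - E (b N) ∈ filt ht R N := by
      have : E (onePlusPowSubOne f c) - E (b N)
          = euler ht R (onePlusPowSubOne f c - b N) + f * euler ht R (onePlusPowSubOne f c - b N)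
            - c • ((onePlusPowSubOne f c - b N) * euler ht R f) := by
        simp only [E, map_sub, mul_sub, sub_mul, smul_sub, smul_add]
        abel
      rw [this]
      refine Submodule.sub_mem _ (Submodule.add_mem _ (euler_mem_filt h2) ?_)
        (Submodule.smul_mem _ _ ?_)
      · exact filt_anti (Nat.le_add_left _ _)
          (mul_mem_filt h (mem_filt_one h f) (euler_mem_filt h2))
      · exact filt_anti (Nat.le_add_right _ _)
          (mul_mem_filt h h2 (mem_filt_one h (euler ht R f)))
    have := Submodule.add_mem _ h3 h1
    rwa [sub_add_cancel] at this
  have := hE (onePlusPowSubOne f c)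
  rw [hlim, Unitization.inr_zero] at this
  exact (sub_eq_zero.1 this.symm)

theorem one_add_mul_onePlusPow_neg_one (h : IsHeight ht) (f : GradedSeries S R) :
    (1 + (f : Unital S R)) * (1 + (onePlusPowSubOne f (-1) : Unital S R)) = 1 := by
  let q := onePlusPowSubOne f (-1)
  have h1 : euler ht R (f + q + f * q) = 0 := by
    refine Unitization.inr_injective (R := ℂ) ?_
    have h2 := euler_onePlusPowSubOne h f (-1)
    simp only [map_neg, map_one] at h2
    simp only [map_add, euler_mul h, Unitization.inr_add, Unitization.inr_mul, Unitization.inr_zero]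
    linear_combination h2
  have h2 : f + q + f * q = 0 := by rw [← eulerInv_euler h (f + q + f * q), h1, map_zero]
  have h3 := congrArg (fun t : GradedSeries S R => (t : Unital S R)) h2
  simp only [Unitization.inr_add, Unitization.inr_mul, Unitization.inr_zero] at h3
  linear_combination h3

/-- The logarithm `-log (1 - f)`, as the solution of `θ(-log (1 - f)) = θ(f) / (1 - f)` for the
Euler derivation `θ`. -/
def negLog (ht : S → ℤ) (f : GradedSeries S R) : GradedSeries S R :=
  eulerInv ht R (euler ht R f + onePlusPowSubOne (-f) (-1) * euler ht R f)

theorem inr_euler_negLog (h : IsHeight ht) (f : GradedSeries S R) :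
    (1 - (f : Unital S R)) * (euler ht R (negLog ht f) : Unital S R) = euler ht R f := by
  have h1 := one_add_mul_onePlusPow_neg_one h (-f)
  rw [Unitization.inr_neg] at h1
  rw [negLog, euler_eulerInv h, Unitization.inr_add, Unitization.inr_mul]
  linear_combination (euler ht R f : Unital S R) * h1

theorem eq_negLog (h : IsHeight ht) {f g : GradedSeries S R}
    (hg : (1 - (f : Unital S R)) * (euler ht R g : Unital S R) = euler ht R f) :
    g = negLog ht f := by
  have h1 := one_add_mul_onePlusPow_neg_one h (-f)
  rw [Unitization.inr_neg] at h1
  have h2 : euler ht R g = euler ht R (negLog ht f) := by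
    refine Unitization.inr_injective (R := ℂ) ?_
    linear_combination (1 + (onePlusPowSubOne (-f) (-1) : Unital S R)) *
      (hg - inr_euler_negLog h f) + ((euler ht R (negLog ht f) : Unital S R)
        - (euler ht R g : Unital S R)) * h1
  rw [← eulerInv_euler h g, h2, eulerInv_euler h]

theorem negLog_add (h : IsHeight ht) (f g : GradedSeries S R) :
    negLog ht f + negLog ht g = negLog ht (f + g - f * g) := by
  refine eq_negLog h ?_
  have h1 := inr_euler_negLog h f
  have h2 := inr_euler_negLog h g
  simp only [map_add, map_sub, euler_mul h, Unitization.inr_add, Unitization.inr_sub,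
    Unitization.inr_mul]
  linear_combination (1 - (g : Unital S R)) * h1 + (1 - (f : Unital S R)) * h2

theorem negLog_smul (h : IsHeight ht) (c : ℂ) (f : GradedSeries S R) :
    c • negLog ht f = negLog ht (-(onePlusPowSubOne (-f) c)) := by
  refine eq_negLog h ?_
  have h1 := inr_euler_negLog h f
  have h2 := euler_onePlusPowSubOne h (-f) c
  have h3 := one_add_mul_onePlusPow_neg_one h (-f)
  simp only [map_neg, map_smul, Unitization.inr_neg, inr_smul'] at h2 h3 ⊢
  linear_combination (1 + (onePlusPowSubOne (-f) (-1) : Unital S R)) *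
      (algebraMap ℂ (Unital S R) c * (1 + (onePlusPowSubOne (-f) c : Unital S R)) * h1 + h2)
    - ((1 + (onePlusPowSubOne (-f) c : Unital S R)) * algebraMap ℂ (Unital S R) c
      * (euler ht R (negLog ht f) : Unital S R)
      + (euler ht R (onePlusPowSubOne (-f) c) : Unital S R)) * h3

theorem negLog_sub_mem (h : IsHeight ht) {n : ℕ} {f : GradedSeries S R} (hf : f ∈ filt ht R n) :
    negLog ht f - f ∈ filt ht R (n + 1) := by
  have : negLog ht f - f
      = eulerInv ht R (onePlusPowSubOne (-f) (-1) * euler ht R f) := by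
    rw [negLog, map_add, eulerInv_euler h, add_sub_cancel_left]
  rw [this, add_comm]
  exact eulerInv_mem_filt (mul_mem_filt h (mem_filt_one h _) (euler_mem_filt hf))

theorem negLog_mem_filt (h : IsHeight ht) {n : ℕ} {f : GradedSeries S R} (hf : f ∈ filt ht R n) :
    negLog ht f ∈ filt ht R n := by
  have := Submodule.add_mem _ (filt_anti (Nat.le_succ n) (negLog_sub_mem h hf)) hf
  rwa [sub_add_cancel] at this

/-- `1 - (1 - f) ^ c` is `c f` up to terms of greater height. -/
theorem onePlusPow_sub_mem (h : IsHeight ht) {n : ℕ}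
    {f : GradedSeries S R} (hf : f ∈ filt ht R n) (c : ℂ) :
    -(onePlusPowSubOne (-f) c) - c • f ∈ filt ht R (n + 1) := by
  have h1 := onePlusPowSubOne_sub_mem h (Submodule.neg_mem _ hf) c 1
  rw [Finset.sum_range_one, binomCoeff_zero] at h1
  have h2 : -(onePlusPowSubOne (-f) c) - c • f
      = -(onePlusPowSubOne (-f) c - c • powSucc (-f) 0) := by
    change _ = -(onePlusPowSubOne (-f) c - c • (-f))
    rw [smul_neg]
    abel
  rw [h2]
  exact Submodule.neg_mem _ h1

theorem sub_smul_eq_add {c : ℂ}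
    (a f g : GradedSeries S R) : a - c • f = (a - c • g) + c • (g - f) := by
  rw [smul_sub]
  abel

/-- The series with the single term `x e ^ γ`. -/
def monomial (γ : S × ZMod 2) : R →ₗ[ℂ] GradedSeries S R :=
  open Classical in LinearMap.single ℂ (fun _ : S × ZMod 2 => R) γ

open Classical in
theorem monomial_apply (γ : S × ZMod 2) (x : R)
    (δ : S × ZMod 2) : monomial γ x δ = if δ = γ then x else 0 := by
  change Pi.single (M := fun _ => R) γ x δ = _
  rw [Pi.single_apply]

/-- A series in heights from `n` on is modulo greater heights the sum of its terms of
height `n`. -/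
theorem sum_monomial_sub_mem {n : ℕ}
    {f : GradedSeries S R} (hf : f ∈ filt ht R n) (s : Finset (S × ZMod 2))
    (hs : ∀ γ, γ ∈ s ↔ ht γ.1 = n) :
    ∑ γ ∈ s, monomial γ (f γ) - f ∈ filt ht R (n + 1) := by
  classical
  intro δ hδ
  rw [sub_apply, sum_apply]
  rw [(Finset.sum_congr rfl fun γ _ => monomial_apply γ (f γ) δ).trans
    (Finset.sum_ite_eq s δ fun γ => f γ)]
  by_cases hδs : δ ∈ s
  · rw [if_pos hδs, sub_self]
  · have := (hs δ).not.1 hδs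
    rw [if_neg hδs, hf δ (by push_cast at hδ; omega), sub_zero]

end Logarithm

end GradedSeries
end

noncomputable section

/-! ### Elimination in terms of classes -/

namespace Green

open FreeLieSuper GradedSeries

section Modules

variable {K : Type u} [Field K] {G : Type v} [Group G]

/-- The direct sum with a zero module on the left. -/
def subsingletonProdEquiv {V W : Type*} [AddCommGroup V] [Module K V] [AddCommGroup W]
    [Module K W] [Subsingleton V] (ρ : Representation K G V) (σ : Representation K G W) :
    (ρ.prod σ).Equiv σ :=
  Representation.Equiv.mk
    (LinearEquiv.ofLinearMap (LinearMap.snd K _ _) (LinearMap.inr K _ _) (by ext; simp)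
      (LinearMap.ext fun y => Prod.ext (Subsingleton.elim _ _) (by simp)))
    (fun g => LinearMap.ext fun y => by simp)

theorem MatRep.subsingleton {A : MatRep K G} (hA : A.1 = 0) : Subsingleton (Fin A.1 → K) := by
  rw [hA]; infer_instance

theorem MatRep.dim_eq {A B : MatRep K G} (e : A.2.Equiv B.2) : A.1 = B.1 := by
  have := e.toLinearEquiv.finrank_eq
  simpa using this

variable (K G) in
/-- The zero module. -/
def zeroRep : MatRep K G := ⟨0, 1⟩

end Modules

section Classes

set_option linter.unusedSectionVars false

variable {K : Type u} [Field K] {G : Type v} [Group G] {S : Type w} [AddCommSemigroup S]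
  {ht : S → ℤ}

/-- The class of a graded module. -/
def cls (H : S × ZMod 2 → MatRep K G) : GradedSeries S (GreenAlgebra K G) :=
  moduleFunction fun γ => (H γ).2

/-- The class of the free Lie superalgebra of a graded module. -/
def lieCls (H : S × ZMod 2 → MatRep K G) : GradedSeries S (GreenAlgebra K G) :=
  moduleFunction fun γ => componentRep (fun γ => (H γ).2) γ

theorem moduleFunction_congr {V V' : S × ZMod 2 → Type*} [∀ γ, AddCommGroup (V γ)]
    [∀ γ, Module K (V γ)] [∀ γ, Module.Finite K (V γ)] [∀ γ, AddCommGroup (V' γ)]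
    [∀ γ, Module K (V' γ)] {ρ : ∀ γ, Representation K G (V γ)}
    {ρ' : ∀ γ, Representation K G (V' γ)} (e : ∀ γ, Nonempty ((ρ γ).Equiv (ρ' γ))) :
    moduleFunction ρ = moduleFunction ρ' :=
  funext fun γ => greenClass_congr (e γ).some

theorem moduleFunction_componentRep_congr (h : IsHeight ht) {V V' : S × ZMod 2 → Type*}
    [∀ γ, AddCommGroup (V γ)] [∀ γ, Module K (V γ)] [∀ γ, Module.Finite K (V γ)]
    [∀ γ, AddCommGroup (V' γ)] [∀ γ, Module K (V' γ)] {ρ : ∀ γ, Representation K G (V γ)}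
    {ρ' : ∀ γ, Representation K G (V' γ)} (e : ∀ γ, Nonempty ((ρ γ).Equiv (ρ' γ))) :
    moduleFunction (componentRep ρ) = moduleFunction (componentRep ρ') := by
  have := finite_component (K := K) h V
  exact moduleFunction_congr (componentRep_congr fun γ => (e γ).some)

/-- The module `A` placed in degree `γ`. -/
def single (γ : S × ZMod 2) (A : MatRep K G) : S × ZMod 2 → MatRep K G :=
  open Classical in fun δ => if δ = γ then A else zeroRep K G

@[simp] theorem single_same (γ : S × ZMod 2) (A : MatRep K G) : single γ A γ = A := if_pos rfl

theorem single_of_ne {γ δ : S × ZMod 2} (hne : δ ≠ γ) (A : MatRep K G) :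
    single γ A δ = zeroRep K G :=
  if_neg hne

theorem single_congr {γ : S × ZMod 2} {A B : MatRep K G} (e : Nonempty (A.2.Equiv B.2))
    (δ : S × ZMod 2) : Nonempty ((single γ A δ).2.Equiv (single γ B δ).2) := by
  by_cases hδ : δ = γ
  · subst hδ; rwa [single_same, single_same]
  · rw [single_of_ne hδ, single_of_ne hδ]; exact ⟨Representation.Equiv.refl _⟩

/-- Elimination on the level of classes: `[𝔏(U ⊕ V)] = [𝔏(U)] + [𝔏(W)]`, where
`(1 - [U]) (1 - [W]) = 1 - [U ⊕ V]`. -/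
theorem exists_elimination [FiniteDecomposition S] (h : IsHeight ht)
    {U V H : S × ZMod 2 → MatRep K G}
    (e : ∀ γ, Nonempty ((H γ).2.Equiv ((U γ).2.prod (V γ).2))) :
    ∃ W : S × ZMod 2 → MatRep K G, lieCls H = lieCls U + lieCls W ∧
      cls H = cls U + cls W - cls U * cls W ∧
      ∀ δ, (∀ α β, α + β = δ → (U α).1 = 0) → Nonempty ((W δ).2.Equiv (V δ).2) := by
  obtain ⟨W, hW⟩ := exists_tower h U V
  have hfin (V : S × ZMod 2 → Type u) [∀ γ, AddCommGroup (V γ)] [∀ γ, Module K (V γ)]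
    [∀ γ, Module.Finite K (V γ)] := finite_component (K := K) h V
  refine ⟨W, ?_, ?_, fun δ hδ => ?_⟩
  · rw [lieCls, moduleFunction_componentRep_congr h e]
    funext γ
    obtain ⟨f⟩ := elimination_tower h (fun δ => (hW δ).some) γ
    have := hfin (fun γ => (Fin (U γ).1 → K) × (Fin (V γ).1 → K))
    have := hfin (fun γ => (Fin (U γ).1 → K))
    have := hfin (fun γ => (Fin (W γ).1 → K))
    exact (greenClass_congr f).trans (greenClass_prod _ _)
  · have h1 : cls W = cls V + cls U * cls W := by
      funext δ
      have := FiniteDecomposition.finite δ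
      have := Fintype.ofFinite {p : (S × ZMod 2) × (S × ZMod 2) // p.1 + p.2 = δ}
      change greenClass (W δ).2 = greenClass (V δ).2 +
        ∑ᶠ p : {p : (S × ZMod 2) × (S × ZMod 2) // p.1 + p.2 = δ},
          greenClass (U p.1.1).2 * greenClass (W p.1.2).2
      rw [greenClass_congr (hW δ).some, towerStepRep, greenClass_prod, greenClass_piRep,
        finsum_eq_sum_of_fintype]
      simp only [greenClass_tprod]
    have h2 : cls H = cls U + cls V := by
      funext δ
      exact (greenClass_congr (e δ).some).trans (greenClass_prod _ _)
    rw [h2, eq_sub_of_add_eq h1.symm]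
    abel
  · have (p : {p : (S × ZMod 2) × (S × ZMod 2) // p.1 + p.2 = δ}) :
        Subsingleton ((Fin (U p.1.1).1 → K) ⊗[K] (Fin (W p.1.2).1 → K)) := by
      have := MatRep.subsingleton (hδ _ _ p.2)
      infer_instance
    exact ⟨(hW δ).some.trans (prodSubsingletonEquiv _ _)⟩

end Classes

end Green
end

noncomputable section

/-! ### Construction of the logarithmic function -/

namespace Green

open FreeLieSuper GradedSeries

section Existence

set_option linter.unusedSectionVars false

variable {K : Type u} [Field K] {G : Type v} [Group G] {S : Type w} [AddCommSemigroup S]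
  {ht : S → ℤ} [FiniteDecomposition S]

/-- The failure at the degree `ε` of the equation `[𝔏(H)] = Λ (-log (1 - [H]))`. -/
def defect (ht : S → ℤ) (ε : S × ZMod 2)
    (Λ : GradedSeries S (GreenAlgebra K G) →ₗ[ℂ] GreenAlgebra K G)
    (H : S × ZMod 2 → MatRep K G) : GreenAlgebra K G :=
  lieCls H ε - Λ (negLog ht (cls H))

variable {ε : S × ZMod 2} {Λ : GradedSeries S (GreenAlgebra K G) →ₗ[ℂ] GreenAlgebra K G}

theorem defect_congr (h : IsHeight ht) {H H' : S × ZMod 2 → MatRep K G}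
    (e : ∀ γ, Nonempty ((H γ).2.Equiv (H' γ).2)) : defect ht ε Λ H = defect ht ε Λ H' := by
  rw [defect, defect, lieCls, moduleFunction_componentRep_congr h e, cls, moduleFunction_congr e]
  rfl

/-- Elimination of a module `A` in a single degree `γ` changes nothing in heights up to that
of `γ`, and the defect is additive. -/
theorem exists_eliminate_single (h : IsHeight ht) {γ : S × ZMod 2}
    {A : MatRep K G} {V H : S × ZMod 2 → MatRep K G}
    (e : ∀ δ, Nonempty ((H δ).2.Equiv ((single γ A δ).2.prod (V δ).2))) :
    ∃ W : S × ZMod 2 → MatRep K G,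
      defect ht ε Λ H = defect ht ε Λ (single γ A) + defect ht ε Λ W ∧
      ∀ δ, ht δ.1 ≤ ht γ.1 → Nonempty ((W δ).2.Equiv (V δ).2) := by
  obtain ⟨W, h1, h2, h3⟩ := exists_elimination h e
  refine ⟨W, ?_, fun δ hδ => h3 δ ?_⟩
  · rw [defect, defect, defect, h1, h2, ← negLog_add h, map_add, GradedSeries.add_apply]
    abel
  · rintro α β rfl
    have hne : α ≠ γ := by
      rintro rfl
      have := h.pos β.1
      rw [Prod.fst_add, h.add] at hδ
      omega
    rw [single_of_ne hne]
    rfl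

/-- The component of degree `γ` of `H` can be eliminated. -/
theorem exists_peel (h : IsHeight ht) (γ : S × ZMod 2)
    (H : S × ZMod 2 → MatRep K G) :
    ∃ W : S × ZMod 2 → MatRep K G,
      defect ht ε Λ H = defect ht ε Λ (single γ (H γ)) + defect ht ε Λ W ∧ (W γ).1 = 0 ∧
      ∀ δ, ht δ.1 ≤ ht γ.1 → δ ≠ γ → Nonempty ((W δ).2.Equiv (H δ).2) := by
  classical
  have hz : Subsingleton (Fin (zeroRep K G).1 → K) := MatRep.subsingleton rfl
  obtain ⟨W, h1, h2⟩ := exists_eliminate_single (ε := ε) (Λ := Λ) h (γ := γ) (A := H γ)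
    (V := fun δ => if δ = γ then zeroRep K G else H δ) (H := H) (fun δ => by
      by_cases hδ : δ = γ
      · subst hδ
        rw [single_same, if_pos rfl]
        exact ⟨(prodSubsingletonEquiv _ _).symm⟩
      · rw [single_of_ne hδ, if_neg hδ]
        exact ⟨(subsingletonProdEquiv _ _).symm⟩)
  refine ⟨W, h1, ?_, fun δ hδ hne => ?_⟩
  · obtain ⟨f⟩ := h2 γ le_rfl
    rw [if_pos rfl] at f
    exact MatRep.dim_eq f
  · have := h2 δ hδ
    rwa [if_neg hne] at this

/-- A graded module `H` vanishes in heights below `m`. -/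
def VanishesBelow (ht : S → ℤ) (m : ℕ) (H : S × ZMod 2 → MatRep K G) : Prop :=
  ∀ γ : S × ZMod 2, ht γ.1 < m → (H γ).1 = 0

theorem VanishesBelow.cls_mem {m : ℕ} {H : S × ZMod 2 → MatRep K G} (hH : VanishesBelow ht m H) :
    cls H ∈ filt ht (GreenAlgebra K G) m := fun γ hγ => by
  have := MatRep.subsingleton (hH γ hγ)
  exact greenClass_subsingleton _

theorem VanishesBelow.lieCls_mem (h : IsHeight ht) {m : ℕ} {H : S × ZMod 2 → MatRep K G}
    (hH : VanishesBelow ht m H) : lieCls H ∈ filt ht (GreenAlgebra K G) m := fun γ hγ => by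
  classical
  have hle := component_le (K := K) (V := fun γ => Fin (H γ).1 → K)
    (fun γ => if ht γ.1 < m then ⊥ else ⊤) (fun γ v => by
      by_cases hγ : ht γ.1 < m
      · have := MatRep.subsingleton (hH γ hγ)
        rw [Subsingleton.elim v 0, map_zero]
        exact Submodule.zero_mem _
      · rw [if_neg hγ]; trivial)
    (fun α β y z hy _ _ _ => by
      by_cases hα : ht α.1 < m
      · rw [if_pos hα, Submodule.mem_bot] at hy
        rw [hy, map_zero, LinearMap.zero_apply]
        exact Submodule.zero_mem _
      · have hβ := h.pos β.1
        rw [if_neg (by rw [Prod.fst_add, h.add]; omega)]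
        trivial) γ
  rw [if_pos hγ, le_bot_iff] at hle
  have : Subsingleton (component K (fun γ => Fin (H γ).1 → K) γ) := by
    rw [hle]; infer_instance
  exact greenClass_subsingleton _

section Step

variable {m : ℕ}

/-- If the defect vanishes on modules in heights above `m`, then it is additive on modules in a
single degree of height `m`. -/
theorem defect_single_add (h : IsHeight ht)
    (hΛ : ∀ H : S × ZMod 2 → MatRep K G, VanishesBelow ht (m + 1) H → defect ht ε Λ H = 0)
    {γ : S × ZMod 2} (hγ : ht γ.1 = m) (A B C : MatRep K G) (e : C.2.Equiv (A.2.prod B.2)) :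
    defect ht ε Λ (single γ C) = defect ht ε Λ (single γ A) + defect ht ε Λ (single γ B) := by
  have hz : Subsingleton (Fin (zeroRep K G).1 → K) := MatRep.subsingleton rfl
  obtain ⟨W, h1, h2⟩ := exists_eliminate_single (ε := ε) (Λ := Λ) h (γ := γ) (A := A)
    (V := single γ B) (H := single γ C) (fun δ => by
      by_cases hδ : δ = γ
      · subst hδ
        rw [single_same, single_same, single_same]
        exact ⟨e⟩
      · rw [single_of_ne hδ, single_of_ne hδ, single_of_ne hδ]
        exact ⟨(prodSubsingletonEquiv _ _).symm⟩)
  obtain ⟨W', h3, h4, h5⟩ := exists_peel (ε := ε) (Λ := Λ) h γ W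
  have h6 : VanishesBelow ht (m + 1) W' := by
    intro δ hδ
    have hle : ht δ.1 ≤ ht γ.1 := by push_cast at hδ; omega
    by_cases hne : δ = γ
    · rw [hne, h4]
    · obtain ⟨f⟩ := h5 δ hle hne
      obtain ⟨g⟩ := h2 δ hle
      rw [MatRep.dim_eq f, MatRep.dim_eq g, single_of_ne hne]
      rfl
  have h7 : defect ht ε Λ (single γ (W γ)) = defect ht ε Λ (single γ B) := by
    refine defect_congr h (single_congr ?_)
    have := h2 γ le_rfl
    rwa [single_same] at this
  rw [h1, h3, hΛ W' h6, add_zero, h7]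

/-- If the defect vanishes on modules in heights above `m`, then on modules in heights from `m` on
it is the sum of its values on the components of height `m`. -/
theorem defect_eq_sum (h : IsHeight ht)
    (hΛ : ∀ H : S × ZMod 2 → MatRep K G, VanishesBelow ht (m + 1) H → defect ht ε Λ H = 0)
    (s : Finset (S × ZMod 2)) (hs : ∀ γ ∈ s, ht γ.1 = m) (H : S × ZMod 2 → MatRep K G)
    (hH : VanishesBelow ht m H) (hHs : ∀ γ : S × ZMod 2, ht γ.1 = m → γ ∉ s → (H γ).1 = 0) :
    defect ht ε Λ H = ∑ γ ∈ s, defect ht ε Λ (single γ (H γ)) := by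
  classical
  induction s using Finset.induction_on generalizing H with
  | empty =>
    rw [Finset.sum_empty]
    refine hΛ H fun γ hγ => ?_
    push_cast at hγ
    rcases (Int.lt_add_one_iff.1 hγ).lt_or_eq with h1 | h1
    · exact hH γ h1
    · exact hHs γ h1 (Finset.notMem_empty _)
  | insert γ s hγs ih =>
    have hγ := hs γ (Finset.mem_insert_self _ _)
    obtain ⟨W, h1, h2, h3⟩ := exists_peel (ε := ε) (Λ := Λ) h γ H
    rw [h1, Finset.sum_insert hγs, ih (fun δ hδ => hs δ (Finset.mem_insert_of_mem hδ)) W]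
    · congr 1
      refine Finset.sum_congr rfl fun δ hδ => ?_
      refine defect_congr h (single_congr (h3 δ ?_ ?_))
      · rw [hγ, hs δ (Finset.mem_insert_of_mem hδ)]
      · rintro rfl; exact hγs hδ
    · intro δ hδ
      obtain ⟨f⟩ := h3 δ (by omega) (by rintro rfl; omega)
      rw [MatRep.dim_eq f]
      exact hH δ hδ
    · intro δ hδ hδs
      by_cases hne : δ = γ
      · rw [hne, h2]
      · obtain ⟨f⟩ := h3 δ (by omega) hne
        rw [MatRep.dim_eq f]
        exact hHs δ hδ (by simp [hne, hδs])

/-- The descending induction step: a functional whose defect vanishes on modules in heights above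
`m` is corrected on the terms of height `m`. -/
theorem exists_correction (h : IsHeight ht) {n : ℕ} (hmn : m < n)
    (hΛn : ∀ f ∈ filt ht (GreenAlgebra K G) n, Λ f = 0)
    (hΛ : ∀ H : S × ZMod 2 → MatRep K G, VanishesBelow ht (m + 1) H → defect ht ε Λ H = 0) :
    ∃ Λ' : GradedSeries S (GreenAlgebra K G) →ₗ[ℂ] GreenAlgebra K G,
      (∀ f ∈ filt ht (GreenAlgebra K G) n, Λ' f = 0) ∧
      ∀ H : S × ZMod 2 → MatRep K G, VanishesBelow ht m H → defect ht ε Λ' H = 0 := by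
  classical
  have hfin : {γ : S × ZMod 2 | ht γ.1 = m}.Finite :=
    (h.finite_le m).subset fun γ hγ => le_of_eq hγ
  let s := hfin.toFinset
  have hs (γ) : γ ∈ s ↔ ht γ.1 = m := hfin.mem_toFinset
  have hφ (γ : S × ZMod 2) : ∃ φ : GreenAlgebra K G →ₗ[ℂ] GreenAlgebra K G, ht γ.1 = m →
      ∀ A : MatRep K G, φ (greenClass A.2) = defect ht ε Λ (single γ A) := by
    by_cases hγ : ht γ.1 = m
    · obtain ⟨φ, hφ⟩ := exists_linearMap_of_additive
        (fun A : MatRep K G => defect ht ε Λ (single γ A)) (defect_single_add h hΛ hγ)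
      exact ⟨φ, fun _ => hφ⟩
    · exact ⟨0, fun h => absurd h hγ⟩
  choose φ hφ using hφ
  let ev (γ : S × ZMod 2) : GradedSeries S (GreenAlgebra K G) →ₗ[ℂ] GreenAlgebra K G :=
    LinearMap.proj (φ := fun _ : S × ZMod 2 => GreenAlgebra K G) γ
  have hev (γ f) : ev γ f = f γ := rfl
  refine ⟨Λ + ∑ γ ∈ s, φ γ ∘ₗ ev γ, fun f hf => ?_, fun H hH => ?_⟩
  · rw [LinearMap.add_apply, hΛn f hf, LinearMap.sum_apply, zero_add]
    refine Finset.sum_eq_zero fun γ hγ => ?_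
    rw [LinearMap.comp_apply, hev, hf γ, map_zero]
    rw [(hs γ).1 hγ]
    exact_mod_cast hmn
  · have h1 : defect ht ε (Λ + ∑ γ ∈ s, φ γ ∘ₗ ev γ) H
        = defect ht ε Λ H - ∑ γ ∈ s, φ γ (negLog ht (cls H) γ) := by
      rw [defect, defect, LinearMap.add_apply, LinearMap.sum_apply, sub_add_eq_sub_sub]
      rfl
    rw [h1, defect_eq_sum h hΛ s (fun γ hγ => (hs γ).1 hγ) H hH
      (fun γ hγ hγs => absurd ((hs γ).2 hγ) hγs), sub_eq_zero]
    refine Finset.sum_congr rfl fun γ hγ => ?_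
    rw [hs] at hγ
    -- the logarithm does not change the terms of lowest height
    have h2 : negLog ht (cls H) γ = greenClass (H γ).2 := by
      have := negLog_sub_mem h hH.cls_mem γ (by rw [hγ]; push_cast; omega)
      rw [GradedSeries.sub_apply, sub_eq_zero] at this
      exact this
    rw [h2, hφ γ hγ]

end Step

/-- Each coefficient of `[𝔏(H)]` is a linear function of `-log (1 - [H])`. -/
theorem exists_functional (h : IsHeight ht) (ε : S × ZMod 2) :
    ∃ Λ : GradedSeries S (GreenAlgebra K G) →ₗ[ℂ] GreenAlgebra K G,
      (∀ f ∈ filt ht (GreenAlgebra K G) ((ht ε.1).toNat + 1), Λ f = 0) ∧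
      ∀ H : S × ZMod 2 → MatRep K G, lieCls H ε = Λ (negLog ht (cls H)) := by
  have hε := Int.self_le_toNat (ht ε.1)
  suffices ∀ k m : ℕ, m + k = (ht ε.1).toNat + 1 →
      ∃ Λ : GradedSeries S (GreenAlgebra K G) →ₗ[ℂ] GreenAlgebra K G,
      (∀ f ∈ filt ht (GreenAlgebra K G) ((ht ε.1).toNat + 1), Λ f = 0) ∧
      ∀ H : S × ZMod 2 → MatRep K G, VanishesBelow ht m H → defect ht ε Λ H = 0 by
    obtain ⟨Λ, h1, h2⟩ := this _ 0 (zero_add _)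
    refine ⟨Λ, h1, fun H => sub_eq_zero.1 (h2 H fun γ hγ => ?_)⟩
    have := h.pos γ.1
    push_cast at hγ
    omega
  intro k
  induction k with
  | zero =>
    intro m hm
    refine ⟨0, fun _ _ => rfl, fun H hH => ?_⟩
    rw [defect, LinearMap.zero_apply, sub_zero]
    exact hH.lieCls_mem h ε (by omega)
  | succ k ih =>
    intro m hm
    obtain ⟨Λ, h1, h2⟩ := ih (m + 1) (by omega)
    exact exists_correction h (by omega) h1 h2

/-- The logarithmic function of the free Lie superalgebra functor exists. -/
theorem exists_isLogarithmic (h : IsHeight ht) :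
    ∃ D : GradedSeries S (GreenAlgebra K G) → GradedSeries S (GreenAlgebra K G),
      IsLogarithmic ht D ∧ ∀ H : S × ZMod 2 → MatRep K G, lieCls H = D (cls H) := by
  choose Λ h1 h2 using exists_functional (K := K) (G := G) h
  refine ⟨fun f ε => Λ ε (negLog ht f), ⟨fun n _ f hf ε hε => h1 ε _ ?_, fun f g => ?_,
    fun c f => ?_⟩, fun H => funext fun ε => h2 ε H⟩
  · refine filt_anti ?_ (negLog_mem_filt h (n := n) hf)
    have := h.pos ε.1
    omega
  · funext ε
    rw [← negLog_add h, map_add]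
    rfl
  · funext ε
    rw [← negLog_smul h, map_smul]
    rfl

end Existence

/-! ### Uniqueness -/

section Uniqueness

set_option linter.unusedSectionVars false

variable {K : Type u} [Field K] {G : Type v} [Group G] {S : Type w} [AddCommSemigroup S]
  {ht : S → ℤ} [FiniteDecomposition S]

/-- Modulo series of height above `n`, every series of height at least `n` is one on which two
given logarithmic functions agree, provided that they agree on classes of modules. -/
theorem exists_agree (h : IsHeight ht)
    {D D' : GradedSeries S (GreenAlgebra K G) → GradedSeries S (GreenAlgebra K G)}
    (hD : IsLogarithmic ht D) (hD' : IsLogarithmic ht D')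
    (heq : ∀ H : S × ZMod 2 → MatRep K G, D (cls H) = D' (cls H)) {n : ℕ} (hn : 1 ≤ n)
    {f : GradedSeries S (GreenAlgebra K G)} (hf : f ∈ filt ht (GreenAlgebra K G) n) :
    ∃ g ∈ filt ht (GreenAlgebra K G) n, D g = D' g ∧
      g - f ∈ filt ht (GreenAlgebra K G) (n + 1) := by
  classical
  let P (f : GradedSeries S (GreenAlgebra K G)) : Prop :=
    ∃ g ∈ filt ht (GreenAlgebra K G) n, D g = D' g ∧ g - f ∈ filt ht (GreenAlgebra K G) (n + 1)
  have hzero : P 0 := by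
    refine ⟨cls fun _ => zeroRep K G, VanishesBelow.cls_mem fun _ _ => rfl, heq _, ?_⟩
    exact Submodule.sub_mem _ (VanishesBelow.cls_mem fun _ _ => rfl) (Submodule.zero_mem _)
  have hadd {f f'} (hf : P f) (hf' : P f') : P (f + f') := by
    obtain ⟨g, h1, h2, h3⟩ := hf
    obtain ⟨g', h1', h2', h3'⟩ := hf'
    have hm : g * g' ∈ filt ht (GreenAlgebra K G) (n + 1) :=
      filt_anti (by omega) (mul_mem_filt h h1 h1')
    refine ⟨g + g' - g * g', Submodule.sub_mem _ (Submodule.add_mem _ h1 h1')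
      (filt_anti (Nat.le_succ n) hm), ?_, ?_⟩
    · rw [← hD.map_add, ← hD'.map_add, h2, h2']
    · have : g + g' - g * g' - (f + f') = (g - f) + (g' - f') - g * g' := by abel
      rw [this]
      exact Submodule.sub_mem _ (Submodule.add_mem _ h3 h3') hm
  have hsmul (c : ℂ) {f} (hf : P f) : P (c • f) := by
    obtain ⟨g, h1, h2, h3⟩ := hf
    have hm := onePlusPow_sub_mem h h1 c
    refine ⟨-(onePlusPowSubOne (-g) c), ?_, ?_, ?_⟩
    · have := Submodule.add_mem _ (filt_anti (Nat.le_succ n) hm) (Submodule.smul_mem _ c h1)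
      rwa [sub_add_cancel] at this
    · rw [← hD.map_smul, ← hD'.map_smul, h2]
    · rw [sub_smul_eq_add _ f g]
      exact Submodule.add_mem _ hm (Submodule.smul_mem _ c h3)
  have hterm (γ : S × ZMod 2) (hγ : ht γ.1 = n) (x : GreenAlgebra K G) : P (monomial γ x) := by
    let N : Submodule ℂ (GreenAlgebra K G) :=
      { carrier := {x | P (monomial γ x)}
        zero_mem' := by change P (monomial γ 0); rwa [map_zero]
        add_mem' := fun {x y} hx hy => by change P (monomial γ (x + y)); rw [map_add]; exact hadd hx hy
        smul_mem' := fun c x hx => by change P (monomial γ (c • x)); rw [map_smul]; exact hsmul c hx }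
    refine mem_of_greenClass_mem N (fun A => ?_) x
    have hz : Subsingleton (Fin (zeroRep K G).1 → K) := MatRep.subsingleton rfl
    have hcls : monomial γ (greenClass A.2) = cls (single γ A) := by
      funext δ
      rw [monomial_apply]
      change _ = greenClass (single γ A δ).2
      by_cases hδ : δ = γ
      · subst hδ; rw [if_pos rfl, single_same]
      · rw [if_neg hδ, single_of_ne hδ, greenClass_subsingleton]
    change P (monomial γ (greenClass A.2))
    rw [hcls]
    refine ⟨cls (single γ A), ?_, heq _, by rw [sub_self]; exact Submodule.zero_mem _⟩
    refine VanishesBelow.cls_mem fun δ hδ => ?_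
    rw [single_of_ne (by rintro rfl; omega)]
    rfl
  have hfin : {γ : S × ZMod 2 | ht γ.1 = n}.Finite :=
    (h.finite_le n).subset fun γ hγ => le_of_eq hγ
  have hsum : P (∑ γ ∈ hfin.toFinset, monomial γ (f γ)) := by
    have (s : Finset (S × ZMod 2)) (hs : ∀ γ ∈ s, ht γ.1 = n) : P (∑ γ ∈ s, monomial γ (f γ)) := by
      induction s using Finset.induction_on with
      | empty => rwa [Finset.sum_empty]
      | insert γ s hγs ih =>
        rw [Finset.sum_insert hγs]
        exact hadd (hterm γ (hs γ (Finset.mem_insert_self _ _)) _)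
          (ih fun δ hδ => hs δ (Finset.mem_insert_of_mem hδ))
    exact this _ fun γ hγ => hfin.mem_toFinset.1 hγ
  obtain ⟨g, h1, h2, h3⟩ := hsum
  refine ⟨g, h1, h2, ?_⟩
  have h4 := sum_monomial_sub_mem hf hfin.toFinset fun γ => hfin.mem_toFinset
  have := Submodule.add_mem _ h3 h4
  rwa [sub_add_sub_cancel] at this

/-- Logarithmic functions that agree on the classes of modules are equal. -/
theorem isLogarithmic_unique (h : IsHeight ht)
    {D D' : GradedSeries S (GreenAlgebra K G) → GradedSeries S (GreenAlgebra K G)}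
    (hD : IsLogarithmic ht D) (hD' : IsLogarithmic ht D')
    (heq : ∀ H : S × ZMod 2 → MatRep K G, D (cls H) = D' (cls H)) : D = D' := by
  have key (f) (n : ℕ) : ∃ f' ∈ filt ht (GreenAlgebra K G) (n + 1),
      D f - D' f = D f' - D' f' := by
    induction n with
    | zero => exact ⟨f, mem_filt_one h f, rfl⟩
    | succ n ih =>
      obtain ⟨f', hf', e⟩ := ih
      obtain ⟨g, hg, hgD, hgf⟩ := exists_agree h hD hD' heq (Nat.le_add_left 1 n) hf'
      -- divide `1 - f'` by `1 - g`
      let q := -(onePlusPowSubOne (-g) (-1))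
      have hq : q + g ∈ filt ht (GreenAlgebra K G) (n + 1 + 1) := by
        have := onePlusPow_sub_mem h hg (-1)
        rwa [neg_one_smul, sub_neg_eq_add] at this
      have hq1 : q ∈ filt ht (GreenAlgebra K G) (n + 1) := by
        have := Submodule.sub_mem _ (filt_anti (Nat.le_succ _) hq) hg
        rwa [add_sub_cancel_right] at this
      refine ⟨f' + q - f' * q, ?_, ?_⟩
      · have : f' + q - f' * q = (q + g) - (g - f') - f' * q := by abel
        rw [this]
        exact Submodule.sub_mem _ (Submodule.sub_mem _ hq hgf)
          (filt_anti (by omega) (mul_mem_filt h hf' hq1))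
      · rw [← hD.map_add, ← hD'.map_add, ← hD.map_smul, ← hD'.map_smul, e, hgD]
        abel
  funext f
  refine sub_eq_zero.1 (eq_zero_of_mem_filt (ht := ht) fun n => ?_)
  obtain ⟨f', hf', e⟩ := key f n
  rw [e]
  exact filt_anti (Nat.le_succ n) (Submodule.sub_mem _ (hD.map_filtration _ (by omega) f' hf')
    (hD'.map_filtration _ (by omega) f' hf'))

end Uniqueness

end Green

theorem isHeight_basisHeight {A : Type*} [AddCommGroup A] {ι : Type*} [Fintype ι]
    (b : Module.Basis ι ℤ A) (Γ : AddSubsemigroup A)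
    (hpos : ∀ α : Γ, 0 < basisHeight b (α : A))
    (hlev : ∀ n : ℤ, {α : Γ | basisHeight b (α : A) = n}.Finite) :
    FreeLieSuper.IsHeight fun α : Γ => basisHeight b (α : A) where
  add α β := by simp [basisHeight, Finset.sum_add_distrib]
  pos := hpos
  finite_level := hlev

end

theorem mainTheorem4
    {K : Type u} [Field K] (hK : ringChar K ≠ 2) {G : Type*} [Group G]
    {A : Type*} [AddCommGroup A] {ι : Type*} [Fintype ι] (b : Module.Basis ι ℤ A)
    (Γ : AddSubsemigroup A)
    (hfin : ∀ α : Γ, {s : Multiset Γ | (s.map (fun β : Γ => (β : A))).sum = α}.Finite)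
    (hpos : ∀ α : Γ, 0 < basisHeight b (α : A))
    (hlev : ∀ n : ℤ, {α : Γ | basisHeight b (α : A) = n}.Finite) :
    (∀ (V : Γ × ZMod 2 → Type u) [∀ γ, AddCommGroup (V γ)] [∀ γ, Module K (V γ)]
      [∀ γ, Module.Finite K (V γ)] (γ : Γ × ZMod 2),
      Module.Finite K (FreeLieSuper.component K V γ)) ∧
    ∃! D : GradedSeries Γ (Green.GreenAlgebra K G) → GradedSeries Γ (Green.GreenAlgebra K G),
      GradedSeries.IsLogarithmic (fun α : Γ => basisHeight b (α : A)) D ∧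
      ∀ (V : Γ × ZMod 2 → Type u) [∀ γ, AddCommGroup (V γ)] [∀ γ, Module K (V γ)]
        [∀ γ, Module.Finite K (V γ)] (ρ : ∀ γ, Representation K G (V γ)),
        moduleFunction (FreeLieSuper.componentRep ρ) = D (moduleFunction ρ) := by
  have h := isHeight_basisHeight b Γ hpos hlev
  have : GradedSeries.FiniteDecomposition Γ := ⟨h.finite_antidiagonal⟩
  refine ⟨fun V _ _ _ γ => FreeLieSuper.finite_component h V γ, ?_⟩
  obtain ⟨D, hD, hDV⟩ := Green.exists_isLogarithmic (K := K) (G := G) h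
  refine ⟨D, ⟨hD, fun V _ _ _ ρ => ?_⟩, ?_⟩
  · have e (γ) : Nonempty ((ρ γ).Equiv (Green.matRep (ρ γ)).2) := ⟨Green.matRepEquiv _⟩
    rw [Green.moduleFunction_componentRep_congr h e, Green.moduleFunction_congr e]
    exact hDV fun γ => Green.matRep (ρ γ)
  · rintro D' ⟨hD', hDV'⟩
    refine Green.isLogarithmic_unique h hD' hD fun H => ?_
    rw [← hDV H]
    exact (hDV' (fun γ => Fin (H γ).1 → K) fun γ => (H γ).2).symm
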